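/- **Setting.** Let $T$ be a finite rooted tree with positive edge weights $w$ in which exactly one edge $r$ (the root edge) leaves the root. Let $D$ be its depth, i.e. the largest number of edges on a path descending from the root. For an edge $e$, let $p(e)$ be its parent edge and $T_e$ the set consisting of $e$ and all its descendant edges. $T$ is a $(\ge 2)$-HST if $w(p(e))\ge 2\,w(e)$ for every edge $e\ne r$. An instance of multilevel aggregation with delay consists of $T$ and finitely many requests $q$, each with a leaf edge $v_q$, an arrival time $r_q\in\mathbb R$ and a continuous non-decreasing delay function $d_q:[r_q,\infty)\to[0,\infty)$ with $d_q(t)\to\infty$ as $t\to\infty$. A feasible solution is a finite list of transmissions (a time together with a subtree of $T$ containing $r$) such that every request $q$ has its leaf edge in some subtree transmitted at a time $\ge r_q$; it is served at the first such time $t_q$. Its buying cost is the total weight of the transmitted subtrees (counted with repetition), its delay cost is $\sum_q d_q(t_q)$, and its cost is the sum of the two. For a set $Q$ of requests on leaves of $T_e$, let $T_e^Q$ consist of $e$ and all edges on the paths from $e$ to the leaf edges of $Q$. $Q$ saturates $T_e$ at time $t$ if $\sum_{q\in Q}d_q(t)\ge w(T_e^Q)$. A request is pending at time $t$ if it has arrived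 ($r_q\le t$) and is not yet served. **Algorithm.** Every edge $e$ has a counter $c_e$, initially $0$. Whenever a set of pending requests saturates $T_r$ (at the first such time), the algorithm sets $\mathcal T\leftarrow\emptyset$, calls $\mathrm{Explore}(r)$, and transmits $\mathcal T$. $\mathrm{Explore}(e)$, called in a service at time $t$: add $e$ to $\mathcal T$ and, if $e$ is a leaf edge, mark the pending requests on $e$ as served; set the budget $b_e\leftarrow w(e)$. While $b_e\neq 0$ and there is a pending request in $T_e$: let $H=\{e'\in T_e\setminus\mathcal T: p(e')\in\mathcal T\}$; let $t'\ge t$ be the earliest time at which some set of the requests currently pending in $T_e$ saturates $T_h$ for some $h\in H$, and choose an $e'\in H$ for which $T_{e'}$ is saturated at $t'$ by such a set (ties broken arbitrarily); with $y=\min(b_e,\,w(e')-c_{e'})$, increase $c_{e'}$ by $y$ and decrease $b_e$ by $y$; if now $c_{e'}=w(e')$, set $c_{e'}\leftarrow 0$ and call $\mathrm{Explore}(e')$. **Theorem.** There is an absolute constant $C>0$ such that for every instance on a $(\ge2)$-HST $T$ with a single root edge and depth $D$, and for every way of breaking ties: the algorithm makes only finitely many services and every partial execution can be continued to a complete one (after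 which no set of requests ever becomes critical, i.e. saturates $T_r$); and every complete execution yields a feasible solution whose cost $\mathrm{ALG}$ satisfies $$\mathrm{ALG}\;\le\; C\,D\cdot \mathrm{OPT}^{B}+C\,D^{2}\cdot \mathrm{OPT}^{D}$$ for every feasible solution $\mathrm{OPT}$ of the instance (in particular an optimal one), with buying cost $\mathrm{OPT}^B$ and delay cost $\mathrm{OPT}^D$. -/

import Mathlib

/-!
# Online multilevel aggregation with delay

A rooted tree in which a single edge leaves the root is described by the tree order on its *edges*
(equivalently, on its non-root nodes, an edge being identified with its lower endpoint): this is a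
Mathlib `RootedTree`, in which `⊥` is the root edge, `Order.pred e` is the parent edge of `e ≠ ⊥`,
`e ≤ f` means that `e` lies on the path from the root to `f` (with `e = f` allowed), and `IsMax e`
means that `e` is a leaf edge.
-/

noncomputable section

open scoped Classical

namespace Multilevel

/-- The depth of an edge: the number of edges on the path from the root through `e`, including `e`
(so the root edge has depth `1`). -/
def edgeDepth {T : RootedTree} [Fintype T] (e : T) : ℕ :=
  (Finset.univ.filter fun f : T => f ≤ e).card

/-- The depth of the tree: the largest number of edges on a path descending from the root. -/
def treeDepth (T : RootedTree) [Fintype T] : ℕ :=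
  Finset.univ.sup fun e : T => edgeDepth e

/-- An instance of multilevel aggregation with delay: positive edge weights, and requests indexed
by `R`, each with a leaf edge, an arrival time, and a nonnegative, non-decreasing, continuous delay
function (relevant from the arrival time on) which tends to infinity. -/
structure Problem (T : RootedTree) (R : Type*) where
  weight : T → ℝ
  weight_pos : ∀ e, 0 < weight e
  leaf : R → T
  isMax_leaf : ∀ q, IsMax (leaf q)
  arrival : R → ℝ
  delay : R → ℝ → ℝ
  delay_nonneg : ∀ q, 0 ≤ delay q (arrival q)
  delay_mono : ∀ q, MonotoneOn (delay q) (Set.Ici (arrival q))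
  delay_cont : ∀ q, ContinuousOn (delay q) (Set.Ici (arrival q))
  delay_tendsto : ∀ q, Filter.Tendsto (delay q) Filter.atTop Filter.atTop

/-- A transmission: its time and the set of transmitted edges. -/
structure Transmission (T : RootedTree) where
  time : ℝ
  edges : Finset T

/-- The transmitted set of edges is a subtree containing the root (edge). -/
def Transmission.IsSubtree {T : RootedTree} (x : Transmission T) : Prop :=
  ⊥ ∈ x.edges ∧ IsLowerSet (x.edges : Set T)

/-- The state of the algorithm between two services: the transmissions made so far, the counters,
and the requests (arrived or not) which have not been served yet. -/
structure State (T : RootedTree) (R : Type*) where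
  log : List (Transmission T)
  counter : T → ℝ
  unserved : Finset R

/-- The state inside a service: the tree built so far, the counters, and the pending requests. -/
structure ServiceState (T : RootedTree) (R : Type*) where
  tree : Finset T
  counter : T → ℝ
  pending : Finset R

namespace Problem

variable {T : RootedTree} [Fintype T] {R : Type*} [Fintype R] (I : Problem T R)

/-- The tree is a `(≥ β)`-HST. -/
def IsHST (β : ℝ) : Prop :=
  ∀ e : T, e ≠ ⊥ → β * I.weight e ≤ I.weight (Order.pred e)

/-- The weight `w(E)` of a set of edges. -/
def weightOf (E : Finset T) : ℝ := ∑ e ∈ E, I.weight e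

/-- The total delay `d_Q(t)`. -/
def delayOf (Q : Finset R) (t : ℝ) : ℝ := ∑ q ∈ Q, I.delay q t

/-- `T_e^Q`: the subtree spanned by `e` and the leaf edges of the requests of `Q`. -/
def spanned (e : T) (Q : Finset R) : Finset T :=
  Finset.univ.filter fun f => f = e ∨ (e ≤ f ∧ ∃ q ∈ Q, f ≤ I.leaf q)

/-- The requests of `Q` all lie in `T_e`, and `Q` saturates `T_e` at time `t`. -/
def Saturates (e : T) (Q : Finset R) (t : ℝ) : Prop :=
  (∀ q ∈ Q, e ≤ I.leaf q) ∧ I.weightOf (I.spanned e Q) ≤ I.delayOf Q t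

/-! ### Solutions and their costs -/

/-- A solution is a list of transmissions of subtrees containing the root such that every request
is on a leaf edge of a tree transmitted at or after its arrival. -/
def Feasible (S : List (Transmission T)) : Prop :=
  (∀ x ∈ S, x.IsSubtree) ∧ ∀ q, ∃ x ∈ S, I.arrival q ≤ x.time ∧ I.leaf q ∈ x.edges

/-- The time at which `q` is served by a feasible solution: the first transmission, from its
arrival on, which contains its leaf edge. -/
def serviceTime (S : List (Transmission T)) (q : R) : ℝ :=
  sInf {t | ∃ x ∈ S, x.time = t ∧ I.arrival q ≤ t ∧ I.leaf q ∈ x.edges}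

/-- The buying cost of a solution. -/
def buyingCost (S : List (Transmission T)) : ℝ :=
  (S.map fun x => I.weightOf x.edges).sum

/-- The delay cost of a solution. -/
def delayCost (S : List (Transmission T)) : ℝ :=
  ∑ q, I.delay q (I.serviceTime S q)

/-- The total cost of a solution. -/
def cost (S : List (Transmission T)) : ℝ := I.buyingCost S + I.delayCost S

/-! ### The algorithm -/

/-- The live cut under `e`, for the currently built tree `A`. (The root edge is its own
`Order.pred`, but being below `e` and outside `A` while its parent is in `A` excludes it.) -/
def liveCut (A : Finset T) (e : T) : Finset T :=
  Finset.univ.filter fun f => e ≤ f ∧ f ∉ A ∧ Order.pred f ∈ A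

/-- At time `s`, a set of requests of `P` saturates `T_f`. -/
def SaturatedBy (P : Finset R) (f : T) (s : ℝ) : Prop :=
  ∃ Q ⊆ P, I.Saturates f Q s

/-- `f` is a possible choice of `e'` in an iteration of the loop of `Explore(e)` at time `t`: for
the earliest time `t' ≥ t` at which a set of requests pending in `T_e` saturates some `T_h`, with
`h` in the live cut under `e`, `f` is an edge of the live cut for which `T_f` is saturated at `t'`.
Ties are broken arbitrarily. -/
def IsNextEdge (t : ℝ) (e : T) (σ : ServiceState T R) (f : T) : Prop :=
  f ∈ liveCut σ.tree e ∧ ∃ t' : ℝ,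
    IsLeast {s | t ≤ s ∧ ∃ h ∈ liveCut σ.tree e,
      I.SaturatedBy (σ.pending.filter fun q => e ≤ I.leaf q) h s} t' ∧
    I.SaturatedBy (σ.pending.filter fun q => e ≤ I.leaf q) f t'

/-- `Add(e)`: add `e` to the tree; if `e` is a leaf edge, its pending requests become served. -/
def add (σ : ServiceState T R) (e : T) : ServiceState T R where
  tree := insert e σ.tree
  counter := σ.counter
  pending := if IsMax e then σ.pending.filter (fun q => I.leaf q ≠ e) else σ.pending

/-- The amount `y` by which `Invest(e, f)` raises the counter of `f`, when the remaining budget of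
`e` is `b`. -/
def investAmount (b : ℝ) (σ : ServiceState T R) (f : T) : ℝ :=
  min b (I.weight f - σ.counter f)

/-- Set the counter of `f` to `x`. -/
def setCounter (σ : ServiceState T R) (f : T) (x : ℝ) : ServiceState T R :=
  { σ with counter := Function.update σ.counter f x }

/-- `I.ExploreLoop t e b σ σ'`: during a service at time `t`, the loop of `Explore(e)`, entered
with remaining budget `b` in state `σ`, can terminate in state `σ'`. -/
inductive ExploreLoop (t : ℝ) : T → ℝ → ServiceState T R → ServiceState T R → Prop
  /-- The budget is exhausted, or no pending request remains in `T_e`. -/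
  | done {e : T} {b : ℝ} {σ : ServiceState T R}
      (h : b = 0 ∨ ∀ q ∈ σ.pending, ¬ e ≤ I.leaf q) :
      ExploreLoop t e b σ σ
  /-- An iteration after whose investment the counter of `f` is not full. -/
  | invest {e f : T} {b : ℝ} {σ σ' : ServiceState T R}
      (hb : b ≠ 0) (hp : ∃ q ∈ σ.pending, e ≤ I.leaf q)
      (hf : I.IsNextEdge t e σ f)
      (hc : σ.counter f + I.investAmount b σ f ≠ I.weight f)
      (hrest : ExploreLoop t e (b - I.investAmount b σ f)
        (setCounter σ f (σ.counter f + I.investAmount b σ f)) σ') :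
      ExploreLoop t e b σ σ'
  /-- An iteration which fills the counter of `f`: it is reset, `Explore(f)` is called (first
  `Add(f)`, then its loop with budget `w(f)`), and then the loop of `Explore(e)` resumes. -/
  | fill {e f : T} {b : ℝ} {σ σ₁ σ' : ServiceState T R}
      (hb : b ≠ 0) (hp : ∃ q ∈ σ.pending, e ≤ I.leaf q)
      (hf : I.IsNextEdge t e σ f)
      (hc : σ.counter f + I.investAmount b σ f = I.weight f)
      (hcall : ExploreLoop t f (I.weight f) (I.add (setCounter σ f 0) f) σ₁)
      (hrest : ExploreLoop t e (b - I.investAmount b σ f) σ₁ σ') :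
      ExploreLoop t e b σ σ'

/-- `Explore(e)`, called at time `t` in state `σ`, can terminate in state `σ'`. -/
def Explore (t : ℝ) (e : T) (σ σ' : ServiceState T R) : Prop :=
  I.ExploreLoop t e (I.weight e) (I.add σ e) σ'

/-- The requests pending at time `t`: those which have arrived and are not yet served. -/
def pendingAt (s : State T R) (t : ℝ) : Finset R :=
  s.unserved.filter fun q => I.arrival q ≤ t

/-- Some set of requests pending at time `t` is critical, that is, saturates the root edge. -/
def HasCritical (s : State T R) (t : ℝ) : Prop :=
  I.SaturatedBy (I.pendingAt s t) ⊥ t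

/-- One service of the algorithm: at the first time `t` (not before the previous transmissions) at
which a pending set of requests is critical, `Explore(r)` is run on the empty tree, and the
resulting tree is transmitted. -/
def Step (s s' : State T R) : Prop :=
  ∃ (t : ℝ) (σ : ServiceState T R),
    IsLeast {u | (∀ x ∈ s.log, x.time ≤ u) ∧ I.HasCritical s u} t ∧
    I.Explore t ⊥ ⟨∅, s.counter, I.pendingAt s t⟩ σ ∧
    s' = ⟨s.log ++ [⟨t, σ.tree⟩], σ.counter, s.unserved \ (I.pendingAt s t \ σ.pending)⟩

/-- The initial state: nothing transmitted, all counters zero, all requests unserved. -/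
def init (_ : Problem T R) : State T R := ⟨[], fun _ => 0, Finset.univ⟩

/-- `s` can be reached by the algorithm on the instance `I`. -/
def Reachable (s : State T R) : Prop := Relation.ReflTransGen I.Step I.init s

/-- No set of requests becomes critical any more, so the algorithm makes no further service. -/
def Final (s : State T R) : Prop :=
  ∀ u, (∀ x ∈ s.log, x.time ≤ u) → ¬ I.HasCritical s u

end Problem

end Multilevel

end

set_option linter.unusedSectionVars false

noncomputable section

open scoped Classical

namespace Multilevel

namespace Problem

variable {T : RootedTree} [Fintype T] {R : Type*} [Fintype R] {I : Problem T R}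

/-! ### Weights, delays and live cuts -/

/-! Let `N` be the number of services and `S` any feasible solution. The bound combines three
inequalities.

Delay (`Sound.delayCost_le`): requests served at time `t` which arrived strictly before `t` have
total delay at most the weight of the tree they span, since otherwise, by continuity, they would
have been critical earlier. That tree is part of the transmitted one. Requests arriving exactly at
`t` pay only their initial delay, which `S` pays too. So ALG's delay is at most its buying cost plus
the delay of `S`.

Buying (`Execution.buyingCost_le`): every transmission of an edge other than the root edge is paid
for by investments of strict ancestors, and an edge invests at most its weight each time it is
transmitted. The money thus enters at the root and descends through at most `D` levels, giving at
most `D * N * w(⊥)`.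

Root cost (`Execution.root_cost_le`): `N * w(⊥) ≤ S^B + D * S^D`. The core is `Execution.charge`.
Suppose that requests pending at service `i` saturate `T_f` at time `u`, and `S` does not buy `f`
from that service until `u`. Consider the phase of `f`, which starts at the last service `j`
transmitting `f`. If `S` neither buys `f` in this phase nor has delay `w(f)` on requests of `T_f`
arriving in it, then the requests already left over by service `j` have delay exceeding the weight
of their tree without `f`. Hence some live edge below `f` was saturated by `u`, and since `Explore`
always picks the earliest saturation, every edge in which `f` invested at service `j` was saturated
by `u`. The charge `w(f)` then passes to these edges in the proportions of the investments, and the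
argument repeats at service `j`. A phase of `f` receives at most `w(f)` in all, as this is what
fills the counter, so the charges form a flow which ends in costs of `S`.

Termination rests on the HST condition: the budget `w(e)` suffices to fill the first chosen counter,
so the recursion reaches a leaf edge and each service serves a request. -/

lemma weightOf_nonneg (E : Finset T) : 0 ≤ I.weightOf E :=
  Finset.sum_nonneg fun e _ => (I.weight_pos e).le

lemma weightOf_mono {E F : Finset T} (h : E ⊆ F) : I.weightOf E ≤ I.weightOf F :=
  Finset.sum_le_sum_of_subset_of_nonneg h fun e _ _ => (I.weight_pos e).le

lemma mem_spanned {e f : T} {Q : Finset R} :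
    f ∈ I.spanned e Q ↔ f = e ∨ (e ≤ f ∧ ∃ q ∈ Q, f ≤ I.leaf q) := by
  simp [spanned]

lemma spanned_mono (e : T) {Q Q' : Finset R} (h : Q ⊆ Q') : I.spanned e Q ⊆ I.spanned e Q' := by
  intro f
  simp only [mem_spanned]
  rintro (rfl | ⟨h1, q, hq, h2⟩)
  · exact Or.inl rfl
  · exact Or.inr ⟨h1, q, h hq, h2⟩

lemma weight_le_weightOf_spanned (e : T) (Q : Finset R) :
    I.weight e ≤ I.weightOf (I.spanned e Q) :=
  Finset.single_le_sum (f := I.weight) (fun f _ => (I.weight_pos f).le)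
    (mem_spanned.2 (Or.inl rfl))

lemma delay_nonneg_of_le {q : R} {u : ℝ} (h : I.arrival q ≤ u) : 0 ≤ I.delay q u :=
  (I.delay_nonneg q).trans (I.delay_mono q Set.self_mem_Ici h h)

lemma Saturates.nonempty {e : T} {Q : Finset R} {u : ℝ} (h : I.Saturates e Q u) : Q.Nonempty := by
  by_contra hQ
  rw [Finset.not_nonempty_iff_eq_empty] at hQ
  subst hQ
  have h1 := h.2
  have h2 := weight_le_weightOf_spanned (I := I) e ∅
  have h3 := I.weight_pos e
  simp only [delayOf, Finset.sum_empty] at h1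
  linarith

lemma mem_liveCut {A : Finset T} {e f : T} :
    f ∈ liveCut A e ↔ e ≤ f ∧ f ∉ A ∧ Order.pred f ∈ A := by
  simp [liveCut]

/-- The edge wanted is the first one outside `A` on the path to `l`. -/
lemma exists_mem_liveCut {A : Finset T} (hA : IsLowerSet (A : Set T)) {e l : T} (he : e ∈ A)
    (hel : e ≤ l) (hl : l ∉ A) : ∃ h ∈ liveCut A e, h ≤ l := by
  have hne : (Finset.univ.filter fun f : T => f ≤ l ∧ f ∉ A).Nonempty := ⟨l, by simp [hl]⟩
  obtain ⟨h, hh⟩ := Finset.exists_minimal hne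
  obtain ⟨hmem, hmin⟩ := hh
  simp only [Finset.mem_filter, Finset.mem_univ, true_and] at hmem hmin
  have heh : e ≤ h := (le_total_of_directed hel hmem.1).resolve_left
    fun h' => hmem.2 (hA h' he)
  refine ⟨h, mem_liveCut.2 ⟨heh, hmem.2, ?_⟩, hmem.1⟩
  -- A minimal `h` whose parent is also outside `A` equals its own `Order.pred`, hence is `⊥`, which
  -- lies in `A`.
  by_contra hp
  have hpl : Order.pred h ≤ h := Order.pred_le h
  have hmin' : h ≤ Order.pred h := hmin ⟨hpl.trans hmem.1, hp⟩ hpl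
  have hm : IsMin h := Order.min_of_le_pred hmin'
  exact hmem.2 (hA (hm.eq_bot ▸ bot_le) he)

lemma liveCut_eq_of_le {A : Finset T} (hA : IsLowerSet (A : Set T)) {e g h l : T}
    (hg : g ∈ liveCut A e) (hh : h ∈ liveCut A e) (hgl : g ≤ l) (hhl : h ≤ l) : g = h := by
  rw [mem_liveCut] at hg hh
  rcases le_total_of_directed hhl hgl with h' | h'
  · rcases h'.lt_or_eq with h'' | h''
    · exact absurd (hA (Order.le_pred_of_lt h'') hh.2.2) hg.2.1
    · exact h''
  · rcases h'.lt_or_eq with h'' | h''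
    · exact absurd (hA (Order.le_pred_of_lt h'') hg.2.2) hh.2.1
    · exact h''.symm

/-- If the delay of `Q` at time `u` exceeds the weight of `T_e^Q` without `e`, then the part of `Q`
below some edge of the live cut under `e` saturates at time `u`. -/
lemma exists_saturates_of_lt {A : Finset T} (hA : IsLowerSet (A : Set T)) {e : T} (he : e ∈ A)
    {Q : Finset R} (hQ : ∀ q ∈ Q, e ≤ I.leaf q) (hQA : ∀ q ∈ Q, I.leaf q ∉ A) {u : ℝ}
    (hu : I.weightOf (I.spanned e Q) < I.delayOf Q u + I.weight e) :
    ∃ h ∈ liveCut A e, I.Saturates h (Q.filter fun q => h ≤ I.leaf q) u := by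
  by_contra! hcon
  have hlt : ∀ h ∈ liveCut A e, I.delayOf (Q.filter fun q => h ≤ I.leaf q) u ≤
      I.weightOf ((I.spanned e Q).filter fun f => h ≤ f) := by
    intro h hh
    -- The empty part is separate: `h` itself lies in `T_e^Q` only if some request of `Q` is below
    -- it.
    by_cases hne : (Q.filter fun q => h ≤ I.leaf q).Nonempty
    · have h1 : I.delayOf (Q.filter fun q => h ≤ I.leaf q) u <
          I.weightOf (I.spanned h (Q.filter fun q => h ≤ I.leaf q)) := by
        by_contra hge
        exact hcon h hh ⟨fun q hq => (Finset.mem_filter.1 hq).2, not_lt.1 hge⟩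
      refine h1.le.trans (weightOf_mono fun f hf => ?_)
      obtain ⟨q₀, hq₀⟩ := hne
      rw [Finset.mem_filter] at hq₀
      have heh := (mem_liveCut.1 hh).1
      rw [mem_spanned] at hf
      rw [Finset.mem_filter, mem_spanned]
      rcases hf with rfl | ⟨h2, q, hq, h3⟩
      · exact ⟨Or.inr ⟨heh, q₀, hq₀.1, hq₀.2⟩, le_rfl⟩
      · exact ⟨Or.inr ⟨heh.trans h2, q, (Finset.mem_filter.1 hq).1, h3⟩, h2⟩
    · rw [Finset.not_nonempty_iff_eq_empty.1 hne]
      simpa [delayOf] using weightOf_nonneg _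
  have hQsum : I.delayOf Q u =
      ∑ h ∈ liveCut A e, I.delayOf (Q.filter fun q => h ≤ I.leaf q) u := by
    unfold delayOf
    rw [← Finset.sum_biUnion]
    · refine Finset.sum_congr ?_ fun _ _ => rfl
      ext q
      simp only [Finset.mem_biUnion, Finset.mem_filter]
      constructor
      · intro hq
        obtain ⟨h, hh, hl⟩ := exists_mem_liveCut hA he (hQ q hq) (hQA q hq)
        exact ⟨h, hh, hq, hl⟩
      · rintro ⟨_, _, hq, _⟩
        exact hq
    · intro g hg h hh hgh
      refine Finset.disjoint_left.2 fun q hq hq' => hgh ?_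
      exact liveCut_eq_of_le hA hg hh (Finset.mem_filter.1 hq).2 (Finset.mem_filter.1 hq').2
  -- The subtrees below distinct live edges are disjoint and all miss `e`; this is where the slack
  -- `w(e)` comes from.
  have hwsum : ∑ h ∈ liveCut A e, I.weightOf ((I.spanned e Q).filter fun f => h ≤ f) ≤
      I.weightOf ((I.spanned e Q).erase e) := by
    unfold weightOf
    rw [← Finset.sum_biUnion]
    · refine weightOf_mono fun f hf => ?_
      simp only [Finset.mem_biUnion, Finset.mem_filter] at hf
      obtain ⟨h, hh, hf, hhf⟩ := hf
      refine Finset.mem_erase.2 ⟨?_, hf⟩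
      rintro rfl
      exact (mem_liveCut.1 hh).2.1 (hA hhf he)
    · intro g hg h hh hgh
      refine Finset.disjoint_left.2 fun f hf hf' => hgh ?_
      exact liveCut_eq_of_le hA hg hh (Finset.mem_filter.1 hf).2 (Finset.mem_filter.1 hf').2
  have herase : I.weightOf ((I.spanned e Q).erase e) + I.weight e =
      I.weightOf (I.spanned e Q) :=
    Finset.sum_erase_add _ _ (mem_spanned.2 (Or.inl rfl))
  have := Finset.sum_le_sum hlt
  linarith

/-! ### First times of saturation -/

/-- Delays are continuous only from arrival on, hence the restriction to `[t, ∞)`. Closedness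
ensures that earliest saturation times are attained. -/
lemma isClosed_saturated {Q : Finset R} {e : T} {t : ℝ} (ht : ∀ q ∈ Q, I.arrival q ≤ t) :
    IsClosed {u | t ≤ u ∧ I.Saturates e Q u} := by
  by_cases hQ : ∀ q ∈ Q, e ≤ I.leaf q
  · have hc : ContinuousOn (fun u => I.delayOf Q u) (Set.Ici t) :=
      continuousOn_finsetSum _ fun q hq =>
        (I.delay_cont q).mono (Set.Ici_subset_Ici.2 (ht q hq))
    have := hc.preimage_isClosed_of_isClosed isClosed_Ici
      (isClosed_Ici (a := I.weightOf (I.spanned e Q)))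
    convert this using 1
    ext u
    simp [Saturates]
    tauto
  · have : {u | t ≤ u ∧ I.Saturates e Q u} = ∅ := by
      ext u
      simp [Saturates, hQ]
    rw [this]
    exact isClosed_empty

lemma exists_saturates_singleton {q : R} {e : T} (h : e ≤ I.leaf q) (t : ℝ) :
    ∃ u, t ≤ u ∧ I.Saturates e {q} u := by
  obtain ⟨u, hu, htu⟩ := ((I.delay_tendsto q).eventually_ge_atTop
    (I.weightOf (I.spanned e {q})) |>.and (Filter.eventually_ge_atTop t)).exists
  exact ⟨u, htu, by simpa using h, by simpa [delayOf] using hu⟩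

/-- The candidate times form a finite union of closed sets, bounded below by `t`, and nonempty
because a single pending request eventually saturates the live edge above it. -/
lemma exists_isNextEdge {t : ℝ} {e : T} {σ : ServiceState T R}
    (hA : IsLowerSet (σ.tree : Set T)) (he : e ∈ σ.tree)
    (hleaf : ∀ q ∈ σ.pending, I.leaf q ∉ σ.tree) (harr : ∀ q ∈ σ.pending, I.arrival q ≤ t)
    (hp : ∃ q ∈ σ.pending, e ≤ I.leaf q) : ∃ f, I.IsNextEdge t e σ f := by
  obtain ⟨q, hq, heq⟩ := hp
  obtain ⟨h, hh, hhq⟩ := exists_mem_liveCut hA he heq (hleaf q hq)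
  obtain ⟨u, htu, hu⟩ := exists_saturates_singleton (I := I) hhq t
  set P := σ.pending.filter fun q => e ≤ I.leaf q with hP
  set Z := {s | t ≤ s ∧ ∃ h ∈ liveCut σ.tree e, I.SaturatedBy P h s} with hZ
  have hne : Z.Nonempty := ⟨u, htu, h, hh, {q}, by simpa [hP] using ⟨hq, heq⟩, hu⟩
  have hZeq : Z = ⋃ h ∈ liveCut σ.tree e, ⋃ Q ∈ P.powerset, {s | t ≤ s ∧ I.Saturates h Q s} := by
    ext s
    simp only [hZ, SaturatedBy, Set.mem_ofPred_eq, Set.mem_iUnion, Finset.mem_powerset, exists_prop]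
    constructor
    · rintro ⟨h1, h, hh, Q, hQ, hs⟩
      exact ⟨h, hh, Q, hQ, h1, hs⟩
    · rintro ⟨h, hh, Q, hQ, h1, hs⟩
      exact ⟨h1, h, hh, Q, hQ, hs⟩
  have hcl : IsClosed Z := by
    rw [hZeq]
    refine isClosed_biUnion_finset fun h _ => isClosed_biUnion_finset fun Q hQ =>
      isClosed_saturated fun q hq => ?_
    exact harr q (Finset.mem_filter.1 (Finset.mem_powerset.1 hQ hq)).1
  have hb : BddBelow Z := ⟨t, fun s hs => hs.1⟩
  have hl : IsLeast Z (sInf Z) := hcl.isLeast_csInf hne hb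
  obtain ⟨_, f, hf, hfs⟩ := hl.1
  exact ⟨f, hf, sInf Z, hl, hfs⟩

/-! ### One service -/

variable (I) in
/-- The invariants of the state inside a service at time `t`. -/
structure Valid (t : ℝ) (σ : ServiceState T R) : Prop where
  lower : IsLowerSet (σ.tree : Set T)
  counter_nonneg : ∀ f, 0 ≤ σ.counter f
  counter_lt : ∀ f, σ.counter f < I.weight f
  leaf_notMem : ∀ q ∈ σ.pending, I.leaf q ∉ σ.tree
  arrived : ∀ q ∈ σ.pending, I.arrival q ≤ t

lemma Valid.setCounter {t : ℝ} {σ : ServiceState T R} (h : I.Valid t σ) {f : T} {x : ℝ}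
    (h0 : 0 ≤ x) (h1 : x < I.weight f) : I.Valid t (setCounter σ f x) where
  lower := h.lower
  counter_nonneg g := by
    by_cases hg : g = f
    · subst hg; simpa [Problem.setCounter] using h0
    · simpa [Problem.setCounter, hg] using h.counter_nonneg g
  counter_lt g := by
    by_cases hg : g = f
    · subst hg; simpa [Problem.setCounter] using h1
    · simpa [Problem.setCounter, hg] using h.counter_lt g
  leaf_notMem := h.leaf_notMem
  arrived := h.arrived

lemma add_pending_subset (σ : ServiceState T R) (f : T) : (I.add σ f).pending ⊆ σ.pending := by
  unfold add
  split_ifs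
  · exact Finset.filter_subset _ _
  · exact subset_rfl

lemma leaf_ne_of_mem_add_pending {σ : ServiceState T R} {f : T} {q : R}
    (hq : q ∈ (I.add σ f).pending) : I.leaf q ≠ f := by
  unfold add at hq
  split_ifs at hq with hf
  · exact (Finset.mem_filter.1 hq).2
  · rintro rfl
    exact hf (I.isMax_leaf q)

lemma leaf_eq_of_notMem_add_pending {σ : ServiceState T R} {f : T} {q : R}
    (hq : q ∈ σ.pending) (hq' : q ∉ (I.add σ f).pending) : I.leaf q = f := by
  unfold add at hq'
  split_ifs at hq' with hf
  · by_contra h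
    exact hq' (Finset.mem_filter.2 ⟨hq, h⟩)
  · exact absurd hq hq'

lemma Valid.add {t : ℝ} {σ : ServiceState T R} (h : I.Valid t σ) {f : T}
    (hf : f = ⊥ ∨ Order.pred f ∈ σ.tree) : I.Valid t (I.add σ f) where
  lower := by
    intro a b hba ha
    simp only [Problem.add, Finset.coe_insert, Set.mem_insert_iff, Finset.mem_coe] at ha ⊢
    rcases ha with rfl | ha
    · rcases hba.lt_or_eq with hlt | heq
      · rcases hf with rfl | hf
        · exact absurd hlt not_lt_bot
        · exact Or.inr (h.lower (Order.le_pred_of_lt hlt) hf)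
      · exact Or.inl heq
    · exact Or.inr (h.lower hba ha)
  counter_nonneg := h.counter_nonneg
  counter_lt := h.counter_lt
  leaf_notMem q hq := by
    have h1 := leaf_ne_of_mem_add_pending hq
    have h2 := h.leaf_notMem q (add_pending_subset σ f hq)
    simp [Problem.add, h1, h2]
  arrived q hq := h.arrived q (add_pending_subset σ f hq)

lemma investAmount_nonneg {t b : ℝ} {σ : ServiceState T R} (h : I.Valid t σ) (hb : 0 ≤ b) (f : T) :
    0 ≤ I.investAmount b σ f :=
  le_min hb (by linarith [h.counter_lt f])

lemma investAmount_le (b : ℝ) (σ : ServiceState T R) (f : T) : I.investAmount b σ f ≤ b :=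
  min_le_left _ _

lemma counter_add_investAmount_le (b : ℝ) (σ : ServiceState T R) (f : T) :
    σ.counter f + I.investAmount b σ f ≤ I.weight f := by
  have : I.investAmount b σ f ≤ I.weight f - σ.counter f := min_le_right _ _
  linarith

lemma investAmount_eq_of_ne {b : ℝ} {σ : ServiceState T R} {f : T}
    (h : σ.counter f + I.investAmount b σ f ≠ I.weight f) : I.investAmount b σ f = b := by
  unfold investAmount at *
  rcases min_choice b (I.weight f - σ.counter f) with h' | h'
  · exact h'
  · rw [h'] at h
    exact absurd (by ring) h

lemma Valid.invest {t b : ℝ} {σ : ServiceState T R} (h : I.Valid t σ) (hb : 0 ≤ b) {f : T}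
    (hc : σ.counter f + I.investAmount b σ f ≠ I.weight f) :
    I.Valid t (Problem.setCounter σ f (σ.counter f + I.investAmount b σ f)) :=
  h.setCounter (add_nonneg (h.counter_nonneg f) (investAmount_nonneg h hb f))
    (lt_of_le_of_ne (counter_add_investAmount_le b σ f) hc)

lemma Valid.call {t : ℝ} {σ : ServiceState T R} (h : I.Valid t σ) {e f : T}
    (hf : I.IsNextEdge t e σ f) : I.Valid t (I.add (Problem.setCounter σ f 0) f) :=
  (h.setCounter le_rfl (I.weight_pos f)).add (Or.inr (mem_liveCut.1 hf.1).2.2)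

lemma ExploreLoop.spec {t : ℝ} {e : T} {b : ℝ} {σ σ' : ServiceState T R}
    (h : I.ExploreLoop t e b σ σ') (hb : 0 ≤ b) (he : e ∈ σ.tree) (hσ : I.Valid t σ) :
    I.Valid t σ' ∧ σ.tree ⊆ σ'.tree ∧ σ'.pending ⊆ σ.pending ∧
      ∀ q ∈ σ.pending, q ∉ σ'.pending → I.leaf q ∈ σ'.tree := by
  induction h with
  | done _ => exact ⟨hσ, subset_rfl, subset_rfl, fun q h1 h2 => absurd h1 h2⟩
  | invest hb0 hp hf hc hrest ih =>
    exact ih (sub_nonneg.2 (investAmount_le _ _ _)) he (hσ.invest hb hc)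
  | @fill e f b σ σ₁ σ' hb0 hp hf hc hcall hrest ih₁ ih₂ =>
    obtain ⟨v₁, t₁, p₁, s₁⟩ := ih₁ (I.weight_pos f).le (by simp [Problem.add]) (hσ.call hf)
    have ht₁ : σ.tree ⊆ σ₁.tree := (Finset.subset_insert _ _).trans t₁
    obtain ⟨v₂, t₂, p₂, s₂⟩ := ih₂ (sub_nonneg.2 (investAmount_le _ _ _)) (ht₁ he) v₁
    refine ⟨v₂, ht₁.trans t₂, p₂.trans (p₁.trans (add_pending_subset _ _)), fun q hq hq' => ?_⟩
    by_cases hq₁ : q ∈ σ₁.pending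
    · exact s₂ q hq₁ hq'
    · refine t₂ ?_
      by_cases hq₀ : q ∈ (I.add (Problem.setCounter σ f 0) f).pending
      · exact s₁ q hq₀ hq₁
      · rw [leaf_eq_of_notMem_add_pending (σ := Problem.setCounter σ f 0) hq hq₀]
        exact t₁ (Finset.mem_insert_self _ _)

/-- Induction on the number of edges outside the tree: an iteration either adds an edge or uses up
the whole budget, after which the loop stops. -/
lemma exists_exploreLoop {t : ℝ} (n : ℕ) : ∀ {e : T} {b : ℝ} {σ : ServiceState T R},
    (Finset.univ \ σ.tree).card ≤ n → 0 ≤ b → e ∈ σ.tree → I.Valid t σ →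
      ∃ σ', I.ExploreLoop t e b σ σ' := by
  induction n with
  | zero =>
    intro e b σ hn hb he hσ
    refine ⟨σ, .done (Or.inr fun q hq => absurd ?_ (hσ.leaf_notMem q hq))⟩
    have := Finset.card_eq_zero.1 (Nat.le_zero.1 hn)
    exact Finset.sdiff_eq_empty_iff_subset.1 this (Finset.mem_univ _)
  | succ n ih =>
    intro e b σ hn hb he hσ
    by_cases hd : b = 0 ∨ ∀ q ∈ σ.pending, ¬ e ≤ I.leaf q
    · exact ⟨σ, .done hd⟩
    push Not at hd
    obtain ⟨hb0, hp⟩ := hd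
    obtain ⟨f, hf⟩ := exists_isNextEdge hσ.lower he hσ.leaf_notMem hσ.arrived hp
    by_cases hc : σ.counter f + I.investAmount b σ f = I.weight f
    · have hv := hσ.call hf
      have hft := (mem_liveCut.1 hf.1).2.1
      have hlt : (Finset.univ \ insert f σ.tree).card ≤ n := by
        have : (Finset.univ \ insert f σ.tree).card < (Finset.univ \ σ.tree).card := by
          refine Finset.card_lt_card ⟨Finset.sdiff_subset_sdiff subset_rfl
            (Finset.subset_insert _ _), fun h => ?_⟩
          have := h (Finset.mem_sdiff.2 ⟨Finset.mem_univ f, hft⟩)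
          simp at this
        omega
      have hmem : f ∈ (I.add (Problem.setCounter σ f 0) f).tree := Finset.mem_insert_self _ _
      obtain ⟨σ₁, h₁⟩ := ih (σ := I.add (Problem.setCounter σ f 0) f) hlt (I.weight_pos f).le
        hmem hv
      obtain ⟨v₁, t₁, -, -⟩ := h₁.spec (I.weight_pos f).le hmem hv
      obtain ⟨σ', h₂⟩ := ih (σ := σ₁) (b := b - I.investAmount b σ f)
        ((Finset.card_le_card (Finset.sdiff_subset_sdiff subset_rfl t₁)).trans hlt)
        (sub_nonneg.2 (investAmount_le _ _ _)) (t₁ (Finset.mem_insert_of_mem he)) v₁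
      exact ⟨σ', .fill hb0 hp hf hc h₁ h₂⟩
    · refine ⟨_, .invest hb0 hp hf hc (.done (Or.inl ?_))⟩
      rw [investAmount_eq_of_ne hc, sub_self]

/-- Needed for all strict ancestors, because an edge of the live cut under `e` need not be a child
of `e`. -/
lemma IsHST.two_mul_weight_le (hI : I.IsHST 2) (f : T) :
    ∀ e, e < f → 2 * I.weight f ≤ I.weight e := by
  induction f using WellFoundedLT.induction with
  | _ f ih =>
    intro e hef
    have hf : f ≠ ⊥ := (bot_le.trans_lt hef).ne'
    have h1 := hI f hf
    rcases (Order.le_pred_of_lt hef).lt_or_eq with h | h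
    · have h2 := ih _ (Order.pred_lt_of_not_isMin (fun h => hf h.eq_bot)) e h
      linarith [I.weight_pos (Order.pred f)]
    · rwa [h]

lemma IsNextEdge.lt {t : ℝ} {e f : T} {σ : ServiceState T R} (hf : I.IsNextEdge t e σ f)
    (he : e ∈ σ.tree) : e < f := by
  have h := mem_liveCut.1 hf.1
  refine lt_of_le_of_ne h.1 ?_
  rintro rfl
  exact h.2.1 he

lemma IsNextEdge.exists_pending {t : ℝ} {e f : T} {σ : ServiceState T R}
    (hf : I.IsNextEdge t e σ f) : ∃ q ∈ σ.pending, f ≤ I.leaf q := by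
  obtain ⟨_, _, _, Q, hQ, hs⟩ := hf
  obtain ⟨q, hq⟩ := hs.nonempty
  exact ⟨q, (Finset.mem_filter.1 (hQ hq)).1, hs.1 q hq⟩

lemma add_pending_ssubset {σ : ServiceState T R} {f : T} (hf : IsMax f)
    (hp : ∃ q ∈ σ.pending, f ≤ I.leaf q) : (I.add σ f).pending ⊂ σ.pending := by
  obtain ⟨q, hq, hfq⟩ := hp
  exact ⟨add_pending_subset σ f, fun h =>
    leaf_ne_of_mem_add_pending (h hq) (hf.eq_of_le hfq).symm⟩

/-- On a `(≥ 2)`-HST, the first iteration of the loop of `Explore(e)` fills the counter of the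
chosen edge, so that the recursion reaches a leaf edge with a pending request. -/
lemma ExploreLoop.ssubset {t : ℝ} {e : T} {b : ℝ} {σ σ' : ServiceState T R}
    (h : I.ExploreLoop t e b σ σ') (hI : I.IsHST 2) (hbw : b = I.weight e) (he : e ∈ σ.tree)
    (hσ : I.Valid t σ) (hp : ∃ q ∈ σ.pending, e ≤ I.leaf q) : σ'.pending ⊂ σ.pending := by
  induction h with
  | @done e b σ h =>
    rcases h with h | h
    · exact absurd (hbw.symm.trans h) (I.weight_pos e).ne'
    · obtain ⟨q, hq, h'⟩ := hp
      exact absurd h' (h q hq)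
  | @invest e f b σ σ' hb0 _ hf hc hrest ih =>
    -- A counter left unfilled would have absorbed the whole budget `w(e) ≥ 2 * w(f)`, more than it
    -- can hold.
    have hy := investAmount_eq_of_ne hc
    have hle := counter_add_investAmount_le (I := I) b σ f
    have hw := hI.two_mul_weight_le f e (hf.lt he)
    have h0 := hσ.counter_nonneg f
    have hpos := I.weight_pos f
    rw [hy] at hle
    linarith
  | @fill e f b σ σ₁ σ' hb0 _ hf hc hcall hrest ih₁ ih₂ =>
    have hmem : f ∈ (I.add (Problem.setCounter σ f 0) f).tree := Finset.mem_insert_self _ _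
    obtain ⟨v₁, t₁, p₁, -⟩ := hcall.spec (I.weight_pos f).le hmem (hσ.call hf)
    have hp₂ := (hrest.spec (sub_nonneg.2 (investAmount_le _ _ _))
      (t₁ (Finset.mem_insert_of_mem he)) v₁).2.2.1
    refine hp₂.trans_ssubset ?_
    by_cases hmax : IsMax f
    · exact p₁.trans_ssubset
        (add_pending_ssubset (σ := Problem.setCounter σ f 0) hmax hf.exists_pending)
    · have hpend : (I.add (Problem.setCounter σ f 0) f).pending = σ.pending := by
        simp [Problem.add, hmax, Problem.setCounter]
      have := ih₁ rfl hmem (hσ.call hf) (by rw [hpend]; exact hf.exists_pending)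
      rwa [hpend] at this

/-! ### The investments made in one service -/

variable (I) in
/-- `X g f` is the amount invested by `g` into the counter of `f` during the part of a service
described by `ExploreLoop t e b σ σ'`. An edge `f` is chosen by `g` only if it is saturated by
pending requests at some time `s`, not later than any time at which remaining requests of `T_g` have
a large delay. -/
structure Investment (t : ℝ) (e : T) (b : ℝ) (σ σ' : ServiceState T R) (X : T → T → ℝ) :
    Prop where
  nonneg : ∀ g f, 0 ≤ X g f
  support : ∀ g f, X g f ≠ 0 → g < f ∧ f ∉ σ.tree ∧ (g = e ∨ g ∈ σ'.tree \ σ.tree)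
  sum_le : ∑ f, X e f ≤ b
  sum_le_of_mem : ∀ g ∈ σ'.tree \ σ.tree, ∑ f, X g f ≤ I.weight g
  exhausted : ∑ f, X e f = b ∨ ∀ q ∈ σ'.pending, ¬ e ≤ I.leaf q
  exhausted_of_mem : ∀ g ∈ σ'.tree \ σ.tree,
    ∑ f, X g f = I.weight g ∨ ∀ q ∈ σ'.pending, ¬ g ≤ I.leaf q
  counter_of_notMem : ∀ f, f ∉ σ'.tree \ σ.tree → σ'.counter f = σ.counter f + ∑ g, X g f
  counter_of_mem : ∀ f ∈ σ'.tree \ σ.tree,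
    σ.counter f + ∑ g, X g f = I.weight f ∧ σ'.counter f = 0
  saturated : ∀ g f, X g f ≠ 0 → ∃ Q ⊆ σ.pending, ∃ s, t ≤ s ∧ I.Saturates f Q s ∧
    ∀ u, t ≤ u → ∀ Q' ⊆ σ'.pending, (∀ q ∈ Q', g ≤ I.leaf q) →
      I.weightOf (I.spanned g Q') < I.delayOf Q' u + I.weight g → s ≤ u

/-- By `exists_saturates_of_lt`, a time `u` of large delay is one at which some live edge is
saturated, so the earliest saturation time used in choosing `f` is at most `u`. -/
lemma IsNextEdge.exists_saturates {t : ℝ} {e f : T} {σ : ServiceState T R}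
    (hf : I.IsNextEdge t e σ f) (hσ : I.Valid t σ) (he : e ∈ σ.tree) :
    ∃ Q ⊆ σ.pending, ∃ s, t ≤ s ∧ I.Saturates f Q s ∧
      ∀ u, t ≤ u → ∀ Q' ⊆ σ.pending, (∀ q ∈ Q', e ≤ I.leaf q) →
        I.weightOf (I.spanned e Q') < I.delayOf Q' u + I.weight e → s ≤ u := by
  obtain ⟨_, s, hs, Q, hQ, hsat⟩ := hf
  refine ⟨Q, hQ.trans (Finset.filter_subset _ _), s, hs.1.1, hsat, fun u hu Q' hQ' hle hlt => ?_⟩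
  obtain ⟨h, hh, hsat'⟩ := exists_saturates_of_lt hσ.lower he hle
    (fun q hq => hσ.leaf_notMem q (hQ' hq)) hlt
  refine hs.2 ⟨hu, h, hh, _, fun q hq => ?_, hsat'⟩
  have hq' := (Finset.mem_filter.1 hq).1
  exact Finset.mem_filter.2 ⟨hQ' hq', hle q hq'⟩

/-- The matrix of a single investment of `y` by `e` into `f`. -/
def singleInvestment (e f : T) (y : ℝ) (g h : T) : ℝ := if g = e ∧ h = f then y else 0

lemma sum_singleInvestment_left (e f : T) (y : ℝ) (h : T) :
    ∑ g, singleInvestment e f y g h = if h = f then y else 0 := by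
  by_cases hf : h = f <;> simp [singleInvestment, hf]

lemma sum_singleInvestment_right (e f : T) (y : ℝ) (g : T) :
    ∑ h, singleInvestment e f y g h = if g = e then y else 0 := by
  by_cases hf : g = e <;> simp [singleInvestment, hf]

lemma singleInvestment_ne_zero {e f : T} {y : ℝ} {g h : T} (hne : singleInvestment e f y g h ≠ 0) :
    g = e ∧ h = f := by
  by_contra hcon
  exact hne (if_neg hcon)

lemma singleInvestment_nonneg {e f : T} {y : ℝ} (hy : 0 ≤ y) (g h : T) :
    0 ≤ singleInvestment e f y g h := by
  unfold singleInvestment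
  split_ifs <;> simp [hy]

lemma Investment.row_eq_zero {t : ℝ} {e : T} {b : ℝ} {σ σ' : ServiceState T R} {X : T → T → ℝ}
    (h : I.Investment t e b σ σ' X) {g : T} (hge : g ≠ e) (hg : g ∉ σ'.tree \ σ.tree) :
    ∑ f, X g f = 0 :=
  Finset.sum_eq_zero fun f _ => by
    by_contra hne
    rcases (h.support g f hne).2.2 with h' | h'
    · exact hge h'
    · exact hg h'

lemma Investment.column_eq_zero {t : ℝ} {e : T} {b : ℝ} {σ σ' : ServiceState T R} {X : T → T → ℝ}
    (h : I.Investment t e b σ σ' X) {f : T} (hf : f ∈ σ.tree) : ∑ g, X g f = 0 :=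
  Finset.sum_eq_zero fun g _ => by
    by_contra hne
    exact (h.support g f hne).2.1 hf

lemma Investment.refl {t : ℝ} {e : T} {b : ℝ} {σ : ServiceState T R} (hb : 0 ≤ b)
    (h : b = 0 ∨ ∀ q ∈ σ.pending, ¬ e ≤ I.leaf q) : I.Investment t e b σ σ fun _ _ => 0 where
  nonneg _ _ := le_rfl
  support _ _ h := absurd rfl h
  sum_le := by simpa using hb
  sum_le_of_mem g hg := by simp at hg
  exhausted := by simpa [eq_comm] using h
  exhausted_of_mem g hg := by simp at hg
  counter_of_notMem f _ := by simp
  counter_of_mem g hg := by simp at hg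
  saturated _ _ h := absurd rfl h

/-- The minimality in `saturated` carries over because it concerns only requests still pending at
the end, a subset of those pending at the choice of `f`. -/
lemma Investment.invest {t b : ℝ} {e f : T} {σ σ' : ServiceState T R} {X : T → T → ℝ}
    (hσ : I.Valid t σ) (he : e ∈ σ.tree) (hb : 0 ≤ b) (hf : I.IsNextEdge t e σ f)
    (hp : σ'.pending ⊆ σ.pending) (hc : σ.counter f + I.investAmount b σ f ≠ I.weight f)
    (hX : I.Investment t e (b - I.investAmount b σ f)
      (Problem.setCounter σ f (σ.counter f + I.investAmount b σ f)) σ' X) :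
    I.Investment t e b σ σ' fun g h => singleInvestment e f (I.investAmount b σ f) g h + X g h where
  nonneg g h := add_nonneg (singleInvestment_nonneg (investAmount_nonneg hσ hb f) g h)
    (hX.nonneg g h)
  support g h hne := by
    by_cases hX0 : X g h = 0
    · rw [hX0, add_zero] at hne
      obtain ⟨rfl, rfl⟩ := singleInvestment_ne_zero hne
      exact ⟨hf.lt he, (mem_liveCut.1 hf.1).2.1, Or.inl rfl⟩
    · exact hX.support g h hX0
  sum_le := by
    rw [Finset.sum_add_distrib, sum_singleInvestment_right, if_pos rfl]
    linarith [hX.sum_le]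
  sum_le_of_mem g hg := by
    have hge : g ≠ e := by rintro rfl; exact (Finset.mem_sdiff.1 hg).2 he
    rw [Finset.sum_add_distrib, sum_singleInvestment_right, if_neg hge, zero_add]
    exact hX.sum_le_of_mem g hg
  exhausted := by
    rw [Finset.sum_add_distrib, sum_singleInvestment_right, if_pos rfl]
    exact hX.exhausted.imp (fun h => by linarith) id
  exhausted_of_mem g hg := by
    have hge : g ≠ e := by rintro rfl; exact (Finset.mem_sdiff.1 hg).2 he
    rw [Finset.sum_add_distrib, sum_singleInvestment_right, if_neg hge, zero_add]
    exact hX.exhausted_of_mem g hg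
  counter_of_notMem h hh := by
    rw [Finset.sum_add_distrib, sum_singleInvestment_left, hX.counter_of_notMem h hh]
    by_cases hhf : h = f
    · subst hhf; simp [Problem.setCounter]; ring
    · simp [Problem.setCounter, hhf]
  counter_of_mem h hh := by
    have := hX.counter_of_mem h hh
    rw [Finset.sum_add_distrib, sum_singleInvestment_left]
    refine ⟨?_, this.2⟩
    rw [← this.1]
    by_cases hhf : h = f
    · subst hhf; simp [Problem.setCounter]; ring
    · simp [Problem.setCounter, hhf]
  saturated g h hne := by
    by_cases hX0 : X g h = 0
    · rw [hX0, add_zero] at hne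
      obtain ⟨rfl, rfl⟩ := singleInvestment_ne_zero hne
      obtain ⟨Q, hQ, s, hs, hsat, hmin⟩ := hf.exists_saturates hσ he
      exact ⟨Q, hQ, s, hs, hsat, fun u hu Q' hQ' => hmin u hu Q' (hQ'.trans hp)⟩
    · exact hX.saturated g h hX0

/-- The row of `f` comes from `X₁` alone, that of `e` from the single investment and `X₂`, and that
of any other new edge from whichever part added it. In columns, `f` receives only the single
investment, while an edge added after the call may have been funded both during and after it. -/
lemma Investment.fill {t b : ℝ} {e f : T} {σ σ₁ σ' : ServiceState T R} {X₁ X₂ : T → T → ℝ}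
    (hσ : I.Valid t σ) (he : e ∈ σ.tree) (hb : 0 ≤ b) (hf : I.IsNextEdge t e σ f)
    (hc : σ.counter f + I.investAmount b σ f = I.weight f)
    (ht₁ : insert f σ.tree ⊆ σ₁.tree) (ht₂ : σ₁.tree ⊆ σ'.tree)
    (hp₁ : σ₁.pending ⊆ σ.pending) (hp₂ : σ'.pending ⊆ σ₁.pending)
    (hX₁ : I.Investment t f (I.weight f) (I.add (Problem.setCounter σ f 0) f) σ₁ X₁)
    (hX₂ : I.Investment t e (b - I.investAmount b σ f) σ₁ σ' X₂) :
    I.Investment t e b σ σ' fun g h =>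
      singleInvestment e f (I.investAmount b σ f) g h + (X₁ g h + X₂ g h) := by
  set y := I.investAmount b σ f
  have hft : f ∉ σ.tree := (mem_liveCut.1 hf.1).2.1
  have hef : e ≠ f := (hf.lt he).ne
  have hf₁ : f ∈ σ₁.tree := ht₁ (Finset.mem_insert_self _ _)
  have hσ₁ : σ.tree ⊆ σ₁.tree := (Finset.subset_insert _ _).trans ht₁
  have htree : (I.add (Problem.setCounter σ f 0) f).tree = insert f σ.tree := rfl
  have hcnt : ∀ h, (I.add (Problem.setCounter σ f 0) f).counter h =
      if h = f then 0 else σ.counter h := fun h => by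
    simp [Problem.add, Problem.setCounter, Function.update_apply]
  have hpnd := add_pending_subset (I := I) (Problem.setCounter σ f 0) f
  have hmem₁ : ∀ {g}, g ∈ σ₁.tree \ (I.add (Problem.setCounter σ f 0) f).tree ↔
      g ∈ σ₁.tree ∧ g ≠ f ∧ g ∉ σ.tree := fun {g} => by
    rw [htree, Finset.mem_sdiff, Finset.mem_insert, not_or]
  have hrow : ∀ g, ∑ h, (singleInvestment e f y g h + (X₁ g h + X₂ g h)) =
      (if g = e then y else 0) + (∑ h, X₁ g h + ∑ h, X₂ g h) := fun g => by
    rw [Finset.sum_add_distrib, Finset.sum_add_distrib, sum_singleInvestment_right]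
  have hcol : ∀ h, ∑ g, (singleInvestment e f y g h + (X₁ g h + X₂ g h)) =
      (if h = f then y else 0) + (∑ g, X₁ g h + ∑ g, X₂ g h) := fun h => by
    rw [Finset.sum_add_distrib, Finset.sum_add_distrib, sum_singleInvestment_left]
  have hrow_e : ∑ h, X₁ e h = 0 :=
    hX₁.row_eq_zero hef fun h => (hmem₁.1 h).2.2 he
  have hrow_f : ∑ h, X₂ f h = 0 :=
    hX₂.row_eq_zero hef.symm fun h => (Finset.mem_sdiff.1 h).2 hf₁
  have hrow_new : ∀ g ∈ σ'.tree \ σ.tree, g ≠ f →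
      (g ∈ σ₁.tree \ (I.add (Problem.setCounter σ f 0) f).tree ∧ ∑ h, X₂ g h = 0) ∨
      (g ∈ σ'.tree \ σ₁.tree ∧ ∑ h, X₁ g h = 0) := by
    intro g hg hgf
    rw [Finset.mem_sdiff] at hg
    have hge : g ≠ e := by rintro rfl; exact hg.2 he
    by_cases hg₁ : g ∈ σ₁.tree
    · exact Or.inl ⟨hmem₁.2 ⟨hg₁, hgf, hg.2⟩,
        hX₂.row_eq_zero hge fun h => (Finset.mem_sdiff.1 h).2 hg₁⟩
    · exact Or.inr ⟨Finset.mem_sdiff.2 ⟨hg.1, hg₁⟩,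
        hX₁.row_eq_zero hgf fun h => hg₁ (Finset.mem_sdiff.1 h).1⟩
  have hlater : ∀ {g}, (∀ q ∈ σ₁.pending, ¬ g ≤ I.leaf q) → ∀ q ∈ σ'.pending, ¬ g ≤ I.leaf q :=
    fun h q hq => h q (hp₂ hq)
  have hcol_f : ∑ g, X₁ g f = 0 ∧ ∑ g, X₂ g f = 0 :=
    ⟨hX₁.column_eq_zero (Finset.mem_insert_self _ _), hX₂.column_eq_zero hf₁⟩
  constructor
  · exact fun g h => add_nonneg (singleInvestment_nonneg (investAmount_nonneg hσ hb f) g h)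
      (add_nonneg (hX₁.nonneg g h) (hX₂.nonneg g h))
  · intro g h hne
    by_cases h1 : X₁ g h = 0
    · by_cases h2 : X₂ g h = 0
      · rw [h1, h2, add_zero, add_zero] at hne
        obtain ⟨rfl, rfl⟩ := singleInvestment_ne_zero hne
        exact ⟨hf.lt he, hft, Or.inl rfl⟩
      · obtain ⟨h3, h4, h5⟩ := hX₂.support g h h2
        refine ⟨h3, fun h => h4 (hσ₁ h), h5.imp id fun h => ?_⟩
        rw [Finset.mem_sdiff] at h ⊢
        exact ⟨h.1, fun h' => h.2 (hσ₁ h')⟩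
    · obtain ⟨h3, h4, h5⟩ := hX₁.support g h h1
      refine ⟨h3, fun h => h4 (Finset.mem_insert_of_mem h), Or.inr (Finset.mem_sdiff.2 ?_)⟩
      rcases h5 with rfl | h5
      · exact ⟨ht₂ hf₁, hft⟩
      · rw [hmem₁] at h5
        exact ⟨ht₂ h5.1, h5.2.2⟩
  · rw [hrow, if_pos rfl, hrow_e]
    linarith [hX₂.sum_le]
  · intro g hg
    have hge : g ≠ e := by rintro rfl; exact (Finset.mem_sdiff.1 hg).2 he
    rw [hrow, if_neg hge, zero_add]
    by_cases hgf : g = f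
    · rw [hgf, hrow_f, add_zero]
      exact hX₁.sum_le
    · rcases hrow_new g hg hgf with ⟨h1, h2⟩ | ⟨h1, h2⟩
      · rw [h2, add_zero]
        exact hX₁.sum_le_of_mem g h1
      · rw [h2, zero_add]
        exact hX₂.sum_le_of_mem g h1
  · rw [hrow, if_pos rfl, hrow_e]
    exact hX₂.exhausted.imp (fun h => by linarith) id
  · intro g hg
    have hge : g ≠ e := by rintro rfl; exact (Finset.mem_sdiff.1 hg).2 he
    rw [hrow, if_neg hge, zero_add]
    by_cases hgf : g = f
    · rw [hgf, hrow_f, add_zero]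
      exact hX₁.exhausted.imp id hlater
    · rcases hrow_new g hg hgf with ⟨h1, h2⟩ | ⟨h1, h2⟩
      · rw [h2, add_zero]
        exact (hX₁.exhausted_of_mem g h1).imp id hlater
      · rw [h2, zero_add]
        exact hX₂.exhausted_of_mem g h1
  · intro h hh
    have hhf : h ≠ f := by
      rintro rfl
      exact hh (Finset.mem_sdiff.2 ⟨ht₂ hf₁, hft⟩)
    have h1 := hX₁.counter_of_notMem h fun h' => by
      rw [hmem₁] at h'
      exact hh (Finset.mem_sdiff.2 ⟨ht₂ h'.1, h'.2.2⟩)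
    have h2 := hX₂.counter_of_notMem h fun h' => by
      rw [Finset.mem_sdiff] at h' hh
      exact hh ⟨h'.1, fun h'' => h'.2 (hσ₁ h'')⟩
    rw [hcnt, if_neg hhf] at h1
    rw [hcol, if_neg hhf, h2, h1]
    ring
  · intro h hh
    rw [hcol]
    by_cases hhf : h = f
    · subst hhf
      rw [if_pos rfl, hcol_f.1, hcol_f.2]
      have h1 := hX₁.counter_of_notMem h fun h' => (hmem₁.1 h').2.1 rfl
      have h2 := hX₂.counter_of_notMem h fun h' => (Finset.mem_sdiff.1 h').2 hf₁
      rw [h2, h1, hcnt, if_pos rfl, hcol_f.1, hcol_f.2]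
      exact ⟨by linarith, by ring⟩
    · rw [if_neg hhf, zero_add]
      rw [Finset.mem_sdiff] at hh
      by_cases hh₁ : h ∈ σ₁.tree
      · have h1 := hX₁.counter_of_mem h (hmem₁.2 ⟨hh₁, hhf, hh.2⟩)
        have h2 := hX₂.counter_of_notMem h fun h' => (Finset.mem_sdiff.1 h').2 hh₁
        have h3 := hX₂.column_eq_zero hh₁
        rw [hcnt, if_neg hhf] at h1
        rw [h2, h3, h1.2, add_zero]
        exact ⟨h1.1, by ring⟩
      · have h1 := hX₁.counter_of_notMem h fun h' => hh₁ (hmem₁.1 h').1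
        have h2 := hX₂.counter_of_mem h (Finset.mem_sdiff.2 ⟨hh.1, hh₁⟩)
        rw [hcnt, if_neg hhf] at h1
        exact ⟨by linarith [h2.1], h2.2⟩
  · intro g h hne
    by_cases h1 : X₁ g h = 0
    · by_cases h2 : X₂ g h = 0
      · rw [h1, h2, add_zero, add_zero] at hne
        obtain ⟨rfl, rfl⟩ := singleInvestment_ne_zero hne
        obtain ⟨Q, hQ, s, hs, hsat, hmin⟩ := hf.exists_saturates hσ he
        exact ⟨Q, hQ, s, hs, hsat, fun u hu Q' hQ' => hmin u hu Q' (hQ'.trans (hp₂.trans hp₁))⟩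
      · obtain ⟨Q, hQ, h3⟩ := hX₂.saturated g h h2
        exact ⟨Q, hQ.trans hp₁, h3⟩
    · obtain ⟨Q, hQ, s, hs, hsat, hmin⟩ := hX₁.saturated g h h1
      exact ⟨Q, hQ.trans hpnd, s, hs, hsat, fun u hu Q' hQ' => hmin u hu Q' (hQ'.trans hp₂)⟩

lemma ExploreLoop.exists_investment {t : ℝ} {e : T} {b : ℝ} {σ σ' : ServiceState T R}
    (h : I.ExploreLoop t e b σ σ') (hb : 0 ≤ b) (he : e ∈ σ.tree) (hσ : I.Valid t σ) :
    ∃ X, I.Investment t e b σ σ' X := by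
  induction h with
  | done h => exact ⟨_, .refl hb h⟩
  | @invest e f b σ σ' hb0 hp hf hc hrest ih =>
    have hb' : 0 ≤ b - I.investAmount b σ f := sub_nonneg.2 (investAmount_le _ _ _)
    obtain ⟨X, hX⟩ := ih hb' he (hσ.invest hb hc)
    exact ⟨_, .invest hσ he hb hf (hrest.spec hb' he (hσ.invest hb hc)).2.2.1 hc hX⟩
  | @fill e f b σ σ₁ σ' hb0 hp hf hc hcall hrest ih₁ ih₂ =>
    have hb' : 0 ≤ b - I.investAmount b σ f := sub_nonneg.2 (investAmount_le _ _ _)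
    have hmem : f ∈ (I.add (Problem.setCounter σ f 0) f).tree := Finset.mem_insert_self _ _
    obtain ⟨v₁, t₁, p₁, -⟩ := hcall.spec (I.weight_pos f).le hmem (hσ.call hf)
    have he₁ := t₁ (Finset.mem_insert_of_mem he)
    obtain ⟨-, t₂, p₂, -⟩ := hrest.spec hb' he₁ v₁
    obtain ⟨X₁, hX₁⟩ := ih₁ (I.weight_pos f).le hmem (hσ.call hf)
    obtain ⟨X₂, hX₂⟩ := ih₂ hb' he₁ v₁
    exact ⟨_, .fill hσ he hb hf hc t₁ t₂ (p₁.trans (add_pending_subset _ _)) p₂ hX₁ hX₂⟩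

/-! ### Services and executions -/

/-- The data of one service: its time, the transmitted tree, the requests pending before and after
it, and the amounts invested by each edge into each counter. -/
structure Service (T : RootedTree) (R : Type*) where
  time : ℝ
  tree : Finset T
  pending : Finset R
  remaining : Finset R
  amount : T → T → ℝ

variable (I) in
/-- `v` describes a service which leads from the state `s` to the state `s'`. -/
structure IsService (s s' : State T R) (v : Service T R) : Prop where
  isLeast : IsLeast {u | (∀ x ∈ s.log, x.time ≤ u) ∧ I.HasCritical s u} v.time
  pending_eq : v.pending = I.pendingAt s v.time
  log_eq : s'.log = s.log ++ [⟨v.time, v.tree⟩]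
  unserved_eq : s'.unserved = s.unserved \ (v.pending \ v.remaining)
  leaf_mem : ∀ q ∈ v.pending, q ∉ v.remaining → I.leaf q ∈ v.tree
  bot_mem : ⊥ ∈ v.tree
  lower : IsLowerSet (v.tree : Set T)
  counter_nonneg : ∀ f, 0 ≤ s'.counter f
  counter_lt : ∀ f, s'.counter f < I.weight f
  nonneg : ∀ g f, 0 ≤ v.amount g f
  support : ∀ g f, v.amount g f ≠ 0 → g < f ∧ g ∈ v.tree
  sum_le : ∀ g ∈ v.tree, ∑ f, v.amount g f ≤ I.weight g
  exhausted : ∀ g ∈ v.tree, ∑ f, v.amount g f = I.weight g ∨ ∀ q ∈ v.remaining, ¬ g ≤ I.leaf q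
  counter_of_notMem : ∀ f, f ∉ v.tree → s'.counter f = s.counter f + ∑ g, v.amount g f
  counter_of_mem : ∀ f ∈ v.tree, f ≠ ⊥ →
    s.counter f + ∑ g, v.amount g f = I.weight f ∧ s'.counter f = 0
  saturated : ∀ g f, v.amount g f ≠ 0 →
    ∃ Q ⊆ v.pending, ∃ s, v.time ≤ s ∧ I.Saturates f Q s ∧
      ∀ u, v.time ≤ u → ∀ Q' ⊆ v.remaining, (∀ q ∈ Q', g ≤ I.leaf q) →
        I.weightOf (I.spanned g Q') < I.delayOf Q' u + I.weight g → s ≤ u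

lemma mem_pendingAt {s : State T R} {t : ℝ} {q : R} :
    q ∈ I.pendingAt s t ↔ q ∈ s.unserved ∧ I.arrival q ≤ t := by
  simp [pendingAt]

/-- The state at the start of a service. -/
lemma valid_start {s : State T R} (h0 : ∀ f, 0 ≤ s.counter f)
    (h1 : ∀ f, s.counter f < I.weight f) (t : ℝ) :
    I.Valid t (I.add ⟨∅, s.counter, I.pendingAt s t⟩ ⊥) :=
  Valid.add ⟨by simp [isLowerSet_empty], h0, h1, by simp, fun _ hq => (mem_pendingAt.1 hq).2⟩
    (Or.inl rfl)

lemma Step.exists_isService {s s' : State T R} (h : I.Step s s') (h0 : ∀ f, 0 ≤ s.counter f)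
    (h1 : ∀ f, s.counter f < I.weight f) : ∃ v, I.IsService s s' v := by
  obtain ⟨t, σ, hleast, hexp, rfl⟩ := h
  have hv := valid_start (I := I) h0 h1 t
  have hmem : ⊥ ∈ (I.add ⟨∅, s.counter, I.pendingAt s t⟩ ⊥).tree := Finset.mem_insert_self _ _
  have hsub := add_pending_subset (I := I) ⟨∅, s.counter, I.pendingAt s t⟩ ⊥
  obtain ⟨v', t', p', s'⟩ := ExploreLoop.spec hexp (I.weight_pos _).le hmem hv
  obtain ⟨X, hX⟩ := ExploreLoop.exists_investment hexp (I.weight_pos _).le hmem hv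
  have hnew : ∀ {g}, g ∈ σ.tree \ (I.add ⟨∅, s.counter, I.pendingAt s t⟩ ⊥).tree ↔
      g ∈ σ.tree ∧ g ≠ ⊥ := fun {g} => by
    simp [add]
  refine ⟨⟨t, σ.tree, I.pendingAt s t, σ.pending, X⟩, ?_⟩
  refine ⟨hleast, rfl, rfl, rfl, ?_, t' hmem, v'.lower, v'.counter_nonneg,
    v'.counter_lt, hX.nonneg, ?_, ?_, ?_, ?_, ?_, ?_⟩
  · intro q hq hq'
    by_cases hq₀ : q ∈ (I.add ⟨∅, s.counter, I.pendingAt s t⟩ ⊥).pending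
    · exact s' q hq₀ hq'
    · rw [leaf_eq_of_notMem_add_pending (σ := ⟨∅, s.counter, I.pendingAt s t⟩) hq hq₀]
      exact t' hmem
  · intro g f hne
    have := hX.support g f hne
    refine ⟨this.1, ?_⟩
    rcases this.2.2 with rfl | h
    · exact t' hmem
    · exact (hnew.1 h).1
  · intro g hg
    by_cases hgb : g = ⊥
    · subst hgb; exact hX.sum_le
    · exact hX.sum_le_of_mem g (hnew.2 ⟨hg, hgb⟩)
  · intro g hg
    by_cases hgb : g = ⊥
    · subst hgb; exact hX.exhausted
    · exact hX.exhausted_of_mem g (hnew.2 ⟨hg, hgb⟩)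
  · intro f hf
    exact hX.counter_of_notMem f fun h => hf (hnew.1 h).1
  · intro f hf hfb
    exact hX.counter_of_mem f (hnew.2 ⟨hf, hfb⟩)
  · intro g f hne
    obtain ⟨Q, hQ, h⟩ := hX.saturated g f hne
    exact ⟨Q, hQ.trans hsub, h⟩

lemma Step.unserved_ssubset {s s' : State T R} (h : I.Step s s') (hI : I.IsHST 2)
    (h0 : ∀ f, 0 ≤ s.counter f) (h1 : ∀ f, s.counter f < I.weight f) :
    s'.unserved ⊂ s.unserved := by
  obtain ⟨t, σ, hleast, hexp, rfl⟩ := h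
  have hv := valid_start (I := I) h0 h1 t
  have hmem : ⊥ ∈ (I.add ⟨∅, s.counter, I.pendingAt s t⟩ ⊥).tree := Finset.mem_insert_self _ _
  obtain ⟨Q, hQ, hsat⟩ := hleast.1.2
  obtain ⟨q, hq⟩ := hsat.nonempty
  have hlt : σ.pending ⊂ I.pendingAt s t := by
    -- If the root edge is a leaf edge, `Add(⊥)` already serves the requests, before the loop
    -- starts.
    by_cases hmax : IsMax (⊥ : T)
    · exact (ExploreLoop.spec hexp (I.weight_pos _).le hmem hv).2.2.1.trans_ssubset
        (add_pending_ssubset (σ := ⟨∅, s.counter, I.pendingAt s t⟩) hmax ⟨q, hQ hq, bot_le⟩)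
    · have hpend : (I.add ⟨∅, s.counter, I.pendingAt s t⟩ ⊥).pending = I.pendingAt s t := by
        simp [add, hmax]
      have := ExploreLoop.ssubset hexp hI rfl hmem hv (by rw [hpend]; exact ⟨q, hQ hq, bot_le⟩)
      rwa [hpend] at this
  obtain ⟨p, hp, hp'⟩ := Finset.exists_of_ssubset hlt
  refine ⟨Finset.sdiff_subset, fun hsub => ?_⟩
  have := hsub (mem_pendingAt.1 hp).1
  exact (Finset.mem_sdiff.1 this).2 (Finset.mem_sdiff.2 ⟨hp, hp'⟩)

/-! ### Existence of the next service -/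

lemma isClosed_arrived_saturated (Q : Finset R) (e : T) :
    IsClosed {u | (∀ q ∈ Q, I.arrival q ≤ u) ∧ I.Saturates e Q u} := by
  by_cases hQ : Q.Nonempty
  · convert isClosed_saturated (I := I) (Q := Q) (e := e) (t := Q.sup' hQ I.arrival)
      (fun q hq => Finset.le_sup' _ hq) using 3
    simp
  · convert isClosed_empty
    ext u
    simp only [Set.mem_ofPred_eq, Set.mem_empty_iff_false, iff_false]
    exact fun h => hQ h.2.nonempty

lemma exists_step {s : State T R} (h0 : ∀ f, 0 ≤ s.counter f)
    (h1 : ∀ f, s.counter f < I.weight f) (hs : ¬ I.Final s) : ∃ s', I.Step s s' := by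
  simp only [Final, not_forall, not_not] at hs
  obtain ⟨u, hu, hc⟩ := hs
  set Z := {u | (∀ x ∈ s.log, x.time ≤ u) ∧ I.HasCritical s u} with hZ
  have hcl : IsClosed Z := by
    have : Z = (⋂ x ∈ {x | x ∈ s.log}, Set.Ici x.time) ∩ ⋃ Q ∈ s.unserved.powerset,
        {u | (∀ q ∈ Q, I.arrival q ≤ u) ∧ I.Saturates ⊥ Q u} := by
      ext v
      simp only [hZ, HasCritical, SaturatedBy, Set.mem_ofPred_eq, Set.mem_inter_iff,
        Set.mem_iInter, Set.mem_Ici, Set.mem_iUnion, Finset.mem_powerset, exists_prop]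
      refine and_congr_right fun _ => exists_congr fun Q => ?_
      constructor
      · exact fun h => ⟨fun q hq => (mem_pendingAt.1 (h.1 hq)).1,
          fun q hq => (mem_pendingAt.1 (h.1 hq)).2, h.2⟩
      · exact fun h => ⟨fun q hq => mem_pendingAt.2 ⟨h.1 hq, h.2.1 q hq⟩, h.2.2⟩
    rw [this]
    exact (isClosed_biInter fun _ _ => isClosed_Ici).inter
      (isClosed_biUnion_finset fun Q _ => isClosed_arrived_saturated Q ⊥)
  -- The log gives no lower bound before the first service; a critical set is nonempty, so the
  -- earliest arrival does.
  have hb : BddBelow Z := by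
    obtain ⟨m, hm⟩ := (Set.finite_range I.arrival).bddBelow
    refine ⟨m, fun v hv => ?_⟩
    obtain ⟨Q, hQ, hsat⟩ := hv.2
    obtain ⟨q, hq⟩ := hsat.nonempty
    exact (hm ⟨q, rfl⟩).trans (mem_pendingAt.1 (hQ hq)).2
  have hl : IsLeast Z (sInf Z) := hcl.isLeast_csInf ⟨u, hu, hc⟩ hb
  obtain ⟨σ, hσ⟩ := exists_exploreLoop (I := I) _ le_rfl (I.weight_pos ⊥).le
    (Finset.mem_insert_self _ _) (valid_start (I := I) h0 h1 (sInf Z))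
  exact ⟨_, sInf Z, σ, hl, hσ, rfl⟩

/-! ### Invariants of the execution and the delay bound -/

variable (I) in
/-- The invariants of the states of the algorithm. -/
structure Sound (s : State T R) : Prop where
  counter_nonneg : ∀ f, 0 ≤ s.counter f
  counter_lt : ∀ f, s.counter f < I.weight f
  subtree : ∀ x ∈ s.log, x.IsSubtree
  -- Two services may happen at the same time; the second then leaves no earlier moment to compare
  -- with, so the bound must be remembered from the first.
  early : ∀ x ∈ s.log, ∀ Q ⊆ s.unserved, (∀ q ∈ Q, I.arrival q < x.time) →
    I.delayOf Q x.time ≤ I.weightOf (I.spanned ⊥ Q)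
  -- `τ q` is some time at which `q` is served; monotonicity later compares it with the first one.
  delay : ∃ τ : R → ℝ,
    (∀ q ∉ s.unserved, ∃ x ∈ s.log, x.time = τ q ∧ I.arrival q ≤ τ q ∧ I.leaf q ∈ x.edges) ∧
    ∑ q ∈ s.unservedᶜ, I.delay q (τ q) ≤
      I.buyingCost s.log + ∑ q ∈ s.unservedᶜ, I.delay q (I.arrival q)

variable (I) in
lemma sound_init : I.Sound I.init where
  counter_nonneg _ := le_rfl
  counter_lt := I.weight_pos
  subtree := by simp [init]
  early := by simp [init]
  delay := ⟨fun _ => 0, by simp [init, buyingCost]⟩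

/-- The total delay of requests which arrived before a service is at most the weight of the tree
they span: no set of requests was critical before. -/
lemma Sound.delayOf_le {s s' : State T R} {v : Service T R} (hs : I.Sound s)
    (hv : I.IsService s s' v) {Q : Finset R} (hQ : Q ⊆ s.unserved)
    (hlt : ∀ q ∈ Q, I.arrival q < v.time) :
    I.delayOf Q v.time ≤ I.weightOf (I.spanned ⊥ Q) := by
  by_cases hx : ∃ x ∈ s.log, v.time ≤ x.time
  · obtain ⟨x, hx, hle⟩ := hx
    have heq : v.time = x.time := le_antisymm hle (hv.isLeast.1.1 x hx)
    rw [heq] at hlt ⊢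
    exact hs.early x hx Q hQ hlt
  push Not at hx
  by_contra! hcon
  -- A strict excess at the service time persists slightly earlier, when all of `Q` has arrived and
  -- every logged service is over, contradicting the choice of the first critical time.
  have hcont : ContinuousAt (fun u => I.delayOf Q u) v.time :=
    tendsto_finsetSum _ fun q hq => (I.delay_cont q).continuousAt (Ici_mem_nhds (hlt q hq))
  have e1 : ∀ᶠ u in nhds v.time, I.weightOf (I.spanned ⊥ Q) < I.delayOf Q u :=
    hcont.eventually_const_lt hcon
  have e2 : ∀ᶠ u in nhds v.time, ∀ q ∈ Q, I.arrival q < u :=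
    (Filter.eventually_all_finset Q).2 fun q hq => eventually_gt_nhds (hlt q hq)
  have e3 : ∀ᶠ u in nhds v.time, ∀ x ∈ {x | x ∈ s.log}, x.time < u :=
    (Filter.eventually_all_finite s.log.finite_toSet).2 fun x hx' => eventually_gt_nhds (hx x hx')
  have e4 := ((e1.and (e2.and e3)).filter_mono (nhdsWithin_le_nhds (s := Set.Iio v.time))).and
    self_mem_nhdsWithin
  obtain ⟨u, ⟨h1, h2, h3⟩, h4⟩ := e4.exists
  have : v.time ≤ u := hv.isLeast.2 ⟨fun x hx => (h3 x hx).le, Q,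
    fun q hq => mem_pendingAt.2 ⟨hQ hq, (h2 q hq).le⟩, fun _ _ => bot_le, h1.le⟩
  exact absurd h4 (not_lt.2 this)

/-- For the delay, the newly served requests are split: those which arrived earlier are paid for by
the transmitted tree, which contains the tree they span, and those arriving just now incur only
their delay at arrival. -/
lemma Sound.next {s s' : State T R} {v : Service T R} (hs : I.Sound s)
    (hv : I.IsService s s' v) : I.Sound s' where
  counter_nonneg := hv.counter_nonneg
  counter_lt := hv.counter_lt
  subtree x hx := by
    rw [hv.log_eq, List.mem_append, List.mem_singleton] at hx
    rcases hx with hx | rfl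
    · exact hs.subtree x hx
    · exact ⟨hv.bot_mem, hv.lower⟩
  early x hx Q hQ hlt := by
    rw [hv.unserved_eq] at hQ
    rw [hv.log_eq, List.mem_append, List.mem_singleton] at hx
    rcases hx with hx | rfl
    · exact hs.early x hx Q (hQ.trans Finset.sdiff_subset) hlt
    · exact hs.delayOf_le hv (hQ.trans Finset.sdiff_subset) hlt
  delay := by
    obtain ⟨τ, hτ, hsum⟩ := hs.delay
    set V := v.pending \ v.remaining with hV
    have hVu : V ⊆ s.unserved := fun q hq => by
      have := (Finset.mem_sdiff.1 hq).1
      rw [hv.pending_eq] at this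
      exact (mem_pendingAt.1 this).1
    have harr : ∀ q ∈ V, I.arrival q ≤ v.time := fun q hq => by
      have := (Finset.mem_sdiff.1 hq).1
      rw [hv.pending_eq] at this
      exact (mem_pendingAt.1 this).2
    have hleaf : ∀ q ∈ V, I.leaf q ∈ v.tree := fun q hq =>
      hv.leaf_mem q (Finset.mem_sdiff.1 hq).1 (Finset.mem_sdiff.1 hq).2
    have hcompl : s'.unservedᶜ = s.unservedᶜ ∪ V := by
      rw [hv.unserved_eq]
      ext q
      rw [Finset.mem_compl, Finset.mem_union, Finset.mem_compl, Finset.mem_sdiff, not_and_or,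
        not_not]
    have hdisj : Disjoint s.unservedᶜ V :=
      Finset.disjoint_left.2 fun q hq hq' => Finset.mem_compl.1 hq (hVu hq')
    refine ⟨fun q => if q ∈ V then v.time else τ q, fun q hq => ?_, ?_⟩
    · by_cases hqV : q ∈ V
      · refine ⟨⟨v.time, v.tree⟩, by simp [hv.log_eq], ?_⟩
        simp only [hqV, if_true]
        exact ⟨trivial, harr q hqV, hleaf q hqV⟩
      · have hq' : q ∉ s.unserved := by
          rw [hv.unserved_eq] at hq
          exact fun h => hq (Finset.mem_sdiff.2 ⟨h, hqV⟩)
        obtain ⟨x, hx, h⟩ := hτ q hq'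
        refine ⟨x, by simp [hv.log_eq, hx], ?_⟩
        simpa only [hqV, if_false] using h
    · rw [hcompl, Finset.sum_union hdisj, Finset.sum_union hdisj]
      have hold : ∑ q ∈ s.unservedᶜ, I.delay q (if q ∈ V then v.time else τ q) =
          ∑ q ∈ s.unservedᶜ, I.delay q (τ q) :=
        Finset.sum_congr rfl fun q hq => by
          rw [if_neg fun h => Finset.mem_compl.1 hq (hVu h)]
      have hnew : ∑ q ∈ V, I.delay q (if q ∈ V then v.time else τ q) = I.delayOf V v.time :=
        Finset.sum_congr rfl fun q hq => by rw [if_pos hq]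
      have hbuy : I.buyingCost s'.log = I.buyingCost s.log + I.weightOf v.tree := by
        simp [buyingCost, hv.log_eq]
      have hsplit := Finset.sum_filter_add_sum_filter_not V (fun q => I.arrival q < v.time)
        fun q => I.delay q v.time
      have hsplit' := Finset.sum_filter_add_sum_filter_not V (fun q => I.arrival q < v.time)
        fun q => I.delay q (I.arrival q)
      have h1 : I.delayOf (V.filter fun q => I.arrival q < v.time) v.time ≤ I.weightOf v.tree := by
        refine (hs.delayOf_le hv ((Finset.filter_subset _ _).trans hVu)
          fun q hq => (Finset.mem_filter.1 hq).2).trans (weightOf_mono fun f hf => ?_)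
        rcases mem_spanned.1 hf with rfl | ⟨_, q, hq, hfq⟩
        · exact hv.bot_mem
        · exact hv.lower hfq (hleaf q (Finset.mem_filter.1 hq).1)
      have h2 : ∑ q ∈ V.filter (fun q => ¬ I.arrival q < v.time), I.delay q v.time =
          ∑ q ∈ V.filter (fun q => ¬ I.arrival q < v.time), I.delay q (I.arrival q) :=
        Finset.sum_congr rfl fun q hq => by
          rw [Finset.mem_filter] at hq
          rw [le_antisymm (not_lt.1 hq.2) (harr q hq.1)]
      have h3 : 0 ≤ ∑ q ∈ V.filter (fun q => I.arrival q < v.time), I.delay q (I.arrival q) :=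
        Finset.sum_nonneg fun q _ => I.delay_nonneg q
      rw [hold, hnew, hbuy]
      unfold delayOf at h1 ⊢
      linarith

lemma Sound.step {s s' : State T R} (hs : I.Sound s) (h : I.Step s s') : I.Sound s' := by
  obtain ⟨v, hv⟩ := h.exists_isService hs.counter_nonneg hs.counter_lt
  exact hs.next hv

lemma Reachable.sound {s : State T R} (h : I.Reachable s) : I.Sound s := by
  induction h with
  | refl => exact I.sound_init
  | tail _ h ih => exact ih.step h

/-! ### Termination and feasibility -/

lemma not_exists_infinite_execution (hI : I.IsHST 2) :
    ¬ ∃ s : ℕ → State T R, s 0 = I.init ∧ ∀ n, I.Step (s n) (s (n + 1)) := by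
  rintro ⟨s, h0, hstep⟩
  have hs : ∀ n, I.Sound (s n) := fun n => by
    induction n with
    | zero => rw [h0]; exact I.sound_init
    | succ n ih => exact ih.step (hstep n)
  have hcard : ∀ n, (s n).unserved.card + n ≤ (s 0).unserved.card := fun n => by
    induction n with
    | zero => simp
    | succ n ih =>
      have := Finset.card_lt_card
        ((hstep n).unserved_ssubset hI (hs n).counter_nonneg (hs n).counter_lt)
      omega
  have := hcard ((s 0).unserved.card + 1)
  omega

lemma Sound.exists_final (hI : I.IsHST 2) (n : ℕ) : ∀ {s : State T R}, I.Sound s →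
    s.unserved.card ≤ n → ∃ s', Relation.ReflTransGen I.Step s s' ∧ I.Final s' := by
  induction n with
  | zero =>
    intro s hs hn
    by_contra! hcon
    obtain ⟨s', h⟩ := exists_step hs.counter_nonneg hs.counter_lt (hcon s .refl)
    have := Finset.card_lt_card (h.unserved_ssubset hI hs.counter_nonneg hs.counter_lt)
    omega
  | succ n ih =>
    intro s hs hn
    by_cases hf : I.Final s
    · exact ⟨s, .refl, hf⟩
    · obtain ⟨s', h⟩ := exists_step hs.counter_nonneg hs.counter_lt hf
      have := Finset.card_lt_card (h.unserved_ssubset hI hs.counter_nonneg hs.counter_lt)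
      obtain ⟨s'', h', hf'⟩ := ih (hs.step h) (by omega)
      exact ⟨s'', .head h h', hf'⟩

/-- An unserved request alone would eventually become critical, as its delay tends to infinity. -/
lemma Final.unserved_eq_empty {s : State T R} (h : I.Final s) : s.unserved = ∅ := by
  by_contra hne
  obtain ⟨q, hq⟩ := Finset.nonempty_iff_ne_empty.2 hne
  obtain ⟨m, hm⟩ := (s.log.finite_toSet.image Transmission.time).bddAbove
  obtain ⟨u, hu, hsat⟩ := exists_saturates_singleton (I := I) (q := q) (e := ⊥) bot_le
    (max m (I.arrival q))
  refine h u (fun x hx => (hm ⟨x, hx, rfl⟩).trans ((le_max_left _ _).trans hu)) ⟨{q}, ?_, hsat⟩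
  rw [Finset.singleton_subset_iff]
  exact mem_pendingAt.2 ⟨hq, (le_max_right _ _).trans hu⟩

lemma Sound.feasible {s : State T R} (hs : I.Sound s) (h : I.Final s) : I.Feasible s.log := by
  obtain ⟨τ, hτ, -⟩ := hs.delay
  refine ⟨hs.subtree, fun q => ?_⟩
  obtain ⟨x, hx, h1, h2, h3⟩ := hτ q (by simp [h.unserved_eq_empty])
  exact ⟨x, hx, h1 ▸ h2, h3⟩

/-! ### Service times -/

lemma finite_serviceTimes (S : List (Transmission T)) (q : R) :
    {t | ∃ x ∈ S, x.time = t ∧ I.arrival q ≤ t ∧ I.leaf q ∈ x.edges}.Finite :=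
  (S.finite_toSet.image Transmission.time).subset fun _ ⟨x, hx, h, _⟩ => ⟨x, hx, h⟩

lemma serviceTime_le {S : List (Transmission T)} {q : R} {x : Transmission T} (hx : x ∈ S)
    (h : I.arrival q ≤ x.time) (hl : I.leaf q ∈ x.edges) : I.serviceTime S q ≤ x.time :=
  csInf_le (finite_serviceTimes S q).bddBelow ⟨x, hx, rfl, h, hl⟩

lemma Feasible.exists_serviceTime {S : List (Transmission T)} (hS : I.Feasible S) (q : R) :
    ∃ x ∈ S, x.time = I.serviceTime S q ∧ I.arrival q ≤ I.serviceTime S q ∧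
      I.leaf q ∈ x.edges := by
  obtain ⟨x, hx, h⟩ := hS.2 q
  have hne : {t | ∃ x ∈ S, x.time = t ∧ I.arrival q ≤ t ∧ I.leaf q ∈ x.edges}.Nonempty :=
    ⟨x.time, x, hx, rfl, h⟩
  exact hne.csInf_mem (finite_serviceTimes S q)

/-- The delay cost of a complete execution exceeds its buying cost by at most the delay cost of any
feasible solution. -/
lemma Sound.delayCost_le {s : State T R} (hs : I.Sound s) (h : I.Final s)
    {S : List (Transmission T)} (hS : I.Feasible S) :
    I.delayCost s.log ≤ I.buyingCost s.log + I.delayCost S := by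
  obtain ⟨τ, hτ, hsum⟩ := hs.delay
  rw [h.unserved_eq_empty, Finset.compl_empty] at hsum
  have h1 : I.delayCost s.log ≤ ∑ q, I.delay q (τ q) := Finset.sum_le_sum fun q _ => by
    obtain ⟨x, hx, h1, h2, h3⟩ := hτ q (by simp [h.unserved_eq_empty])
    obtain ⟨_, _, _, h4, _⟩ := (hs.feasible h).exists_serviceTime q
    exact I.delay_mono q h4 h2 (h1 ▸ serviceTime_le hx (h1 ▸ h2) h3)
  have h2 : ∑ q, I.delay q (I.arrival q) ≤ I.delayCost S := Finset.sum_le_sum fun q _ => by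
    obtain ⟨_, _, _, h4, _⟩ := hS.exists_serviceTime q
    exact I.delay_mono q Set.self_mem_Ici h4 h4
  linarith

/-! ### The buying cost of an execution -/

variable (I) in
/-- The first `N` services of an execution are `v 0, …, v (N - 1)`. -/
structure Execution (N : ℕ) (s : ℕ → State T R) (v : ℕ → Service T R) : Prop where
  init : s 0 = I.init
  service : ∀ i < N, I.IsService (s i) (s (i + 1)) (v i)

lemma Reachable.exists_execution {s' : State T R} (h : I.Reachable s') :
    ∃ N s v, I.Execution N s v ∧ s N = s' := by
  induction h with
  | refl => exact ⟨0, fun _ => I.init, fun _ => ⟨0, ∅, ∅, ∅, fun _ _ => 0⟩, ⟨rfl, by simp⟩, rfl⟩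
  | @tail a b hr h ih =>
    obtain ⟨N, s, v, hex, rfl⟩ := ih
    have hs : I.Sound (s N) := Reachable.sound hr
    obtain ⟨w, hw⟩ := h.exists_isService hs.counter_nonneg hs.counter_lt
    refine ⟨N + 1, Function.update s (N + 1) b, Function.update v N w, ⟨?_, fun i hi => ?_⟩, ?_⟩
    · rw [Function.update_of_ne (by omega)]
      exact hex.init
    · rw [Function.update_of_ne (by omega : i ≠ N + 1)]
      rcases Nat.lt_succ_iff_lt_or_eq.1 hi with hi' | rfl
      · rw [Function.update_of_ne (by omega), Function.update_of_ne (by omega)]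
        exact hex.service i hi'
      · rw [Function.update_self, Function.update_self]
        exact hw
    · rw [Function.update_self]

namespace Execution

variable {N : ℕ} {s : ℕ → State T R} {v : ℕ → Service T R}

lemma counter_nonneg (h : I.Execution N s v) {i : ℕ} (hi : i ≤ N) (f : T) :
    0 ≤ (s i).counter f := by
  rcases i with _ | i
  · rw [h.init]
    exact le_rfl
  · exact (h.service i hi).counter_nonneg f

lemma counter_le (h : I.Execution N s v) {i : ℕ} (hi : i ≤ N) (f : T) :
    (s i).counter f ≤ I.weight f := by
  rcases i with _ | i
  · rw [h.init]
    exact (I.weight_pos f).le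
  · exact ((h.service i hi).counter_lt f).le

lemma mem_log (h : I.Execution N s v) {j i : ℕ} (hji : j < i) (hi : i ≤ N) :
    ⟨(v j).time, (v j).tree⟩ ∈ (s i).log := by
  induction i with
  | zero => omega
  | succ i ih =>
    rw [(h.service i hi).log_eq, List.mem_append, List.mem_singleton]
    rcases Nat.lt_succ_iff_lt_or_eq.1 hji with hji' | rfl
    · exact Or.inl (ih hji' (by omega))
    · exact Or.inr rfl

lemma time_le (h : I.Execution N s v) {j i : ℕ} (hji : j ≤ i) (hi : i < N) :
    (v j).time ≤ (v i).time := by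
  rcases hji.lt_or_eq with hlt | rfl
  · exact (h.service i hi).isLeast.1.1 _ (h.mem_log hlt hi.le)
  · exact le_rfl

lemma unserved_anti (h : I.Execution N s v) {j i : ℕ} (hji : j ≤ i) (hi : i ≤ N) :
    (s i).unserved ⊆ (s j).unserved := by
  induction i, hji using Nat.le_induction with
  | base => exact subset_rfl
  | succ i _ ih =>
    rw [(h.service i hi).unserved_eq]
    exact Finset.sdiff_subset.trans (ih (by omega))

/-- A pending request which had arrived at an earlier service was left over by that service. -/
lemma mem_remaining (h : I.Execution N s v) {j i : ℕ} (hji : j < i) (hi : i < N) {q : R}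
    (hq : q ∈ (v i).pending) (ha : I.arrival q ≤ (v j).time) : q ∈ (v j).remaining := by
  rw [(h.service i hi).pending_eq, mem_pendingAt] at hq
  have h1 := h.unserved_anti (Nat.succ_le_of_lt hji) hi.le hq.1
  rw [(h.service j (hji.trans hi)).unserved_eq, Finset.mem_sdiff] at h1
  by_contra hcon
  refine h1.2 (Finset.mem_sdiff.2 ⟨?_, hcon⟩)
  rw [(h.service j (hji.trans hi)).pending_eq, mem_pendingAt]
  exact ⟨h1.1, ha⟩

lemma buyingCost_eq (h : I.Execution N s v) {n : ℕ} (hn : n ≤ N) :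
    I.buyingCost (s n).log = ∑ i ∈ Finset.range n, I.weightOf (v i).tree := by
  induction n with
  | zero => simp [h.init, Problem.init, buyingCost]
  | succ n ih =>
    rw [Finset.sum_range_succ, ← ih (by omega), (h.service n hn).log_eq]
    simp [buyingCost]

/-- Conservation of money: a transmission of `f` empties a counter containing exactly `w(f)`. -/
lemma counter_add_bought (h : I.Execution N s v) {f : T} (hf : f ≠ ⊥) {n : ℕ} (hn : n ≤ N) :
    (s n).counter f + ∑ i ∈ Finset.range n, (if f ∈ (v i).tree then I.weight f else 0) =
      ∑ i ∈ Finset.range n, ∑ e, (v i).amount e f := by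
  induction n with
  | zero => simp [h.init, Problem.init]
  | succ n ih =>
    have := ih (by omega)
    rw [Finset.sum_range_succ, Finset.sum_range_succ, ← this]
    by_cases hft : f ∈ (v n).tree
    · have := (h.service n hn).counter_of_mem f hft hf
      rw [if_pos hft]
      linarith
    · have := (h.service n hn).counter_of_notMem f hft
      rw [if_neg hft]
      linarith

lemma row_eq_zero (h : I.Execution N s v) {i : ℕ} (hi : i < N) {e : T} (he : e ∉ (v i).tree) :
    ∑ f, (v i).amount e f = 0 :=
  Finset.sum_eq_zero fun f _ => by
    by_contra hne
    exact he ((h.service i hi).support e f hne).2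

end Execution

/-! ### Depth and the flow of money down the tree -/

lemma edgeDepth_lt {e f : T} (h : e < f) : edgeDepth e < edgeDepth f :=
  Finset.card_lt_card ⟨Finset.monotone_filter_right _ fun g _ hg => le_trans hg h.le, fun hsub => by
    have := hsub (Finset.mem_filter.2 ⟨Finset.mem_univ f, le_rfl⟩)
    exact absurd (Finset.mem_filter.1 this).2 h.not_ge⟩

lemma edgeDepth_le (e : T) : edgeDepth e ≤ treeDepth T :=
  Finset.le_sup (f := fun e : T => edgeDepth e) (Finset.mem_univ e)

lemma edgeDepth_bot : edgeDepth (⊥ : T) = 1 := by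
  rw [edgeDepth, Finset.card_eq_one]
  exact ⟨⊥, by ext f; simp⟩

lemma one_le_treeDepth : 1 ≤ treeDepth T :=
  (edgeDepth_bot (T := T)).symm.le.trans (edgeDepth_le ⊥)

/-- The weight of the root edge is the only money which enters the counters in a service, and it
moves down the tree; so each service costs at most `D` times this weight, in total. -/
lemma Execution.buyingCost_le {N : ℕ} {s : ℕ → State T R} {v : ℕ → Service T R}
    (h : I.Execution N s v) :
    I.buyingCost (s N).log ≤ (treeDepth T : ℝ) * (N * I.weight ⊥) := by
  set D : ℝ := (treeDepth T : ℝ) with hD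
  set B : T → ℝ := fun f => ∑ i ∈ Finset.range N, if f ∈ (v i).tree then I.weight f else 0 with hB
  set Y : T → T → ℝ := fun e f => ∑ i ∈ Finset.range N, (v i).amount e f with hY
  have hbuy : I.buyingCost (s N).log = ∑ f, B f := by
    rw [h.buyingCost_eq le_rfl, hB, Finset.sum_comm]
    refine Finset.sum_congr rfl fun i _ => ?_
    simp [weightOf]
  have hB0 : ∀ f, 0 ≤ B f := fun f => Finset.sum_nonneg fun i _ => by
    split_ifs
    exacts [(I.weight_pos f).le, le_rfl]
  have hbot : B ⊥ = N * I.weight ⊥ := by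
    rw [hB]
    simp only
    rw [Finset.sum_congr rfl fun i hi =>
      if_pos (h.service i (Finset.mem_range.1 hi)).bot_mem]
    simp
  have hBY : ∀ f, f ≠ ⊥ → B f ≤ ∑ e, Y e f := fun f hf => by
    have h1 := h.counter_add_bought hf le_rfl
    have h2 := h.counter_nonneg le_rfl f
    rw [hY, Finset.sum_comm]
    linarith
  have hYB : ∀ e, ∑ f, Y e f ≤ B e := fun e => by
    rw [hY, Finset.sum_comm]
    refine Finset.sum_le_sum fun i hi => ?_
    rw [Finset.mem_range] at hi
    split_ifs with he
    · exact (h.service i hi).sum_le e he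
    · exact (h.row_eq_zero hi he).le
  have hY0 : ∀ e f, 0 ≤ Y e f := fun e f => Finset.sum_nonneg fun i hi =>
    (h.service i (Finset.mem_range.1 hi)).nonneg e f
  have hYlt : ∀ e f, Y e f ≠ 0 → e < f := fun e f hne => by
    obtain ⟨i, hi, hne'⟩ := Finset.exists_ne_zero_of_sum_ne_zero hne
    exact ((h.service i (Finset.mem_range.1 hi)).support e f hne').1
  have hdep : ∀ f : T, (edgeDepth f : ℝ) ≤ D := fun f =>
    Nat.cast_le.2 (edgeDepth_le f)
  -- Purchases are weighted by the number of levels remaining. Each investment goes strictly down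
  -- and loses at least one unit of this weight, so after summation a surplus of `∑ f, B f` is
  -- bounded by the root's share `D * B ⊥`.
  have h1 : ∀ f, B f * (D + 1 - edgeDepth f) ≤
      ∑ e, Y e f * (D - edgeDepth e) + if f = ⊥ then D * B ⊥ else 0 := by
    intro f
    by_cases hf : f = ⊥
    · subst hf
      have : 0 ≤ ∑ e, Y e ⊥ * (D - edgeDepth e) := Finset.sum_nonneg fun e _ =>
        mul_nonneg (hY0 e ⊥) (sub_nonneg.2 (hdep e))
      rw [if_pos rfl, edgeDepth_bot]
      push_cast
      linarith
    · rw [if_neg hf, add_zero]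
      refine (mul_le_mul_of_nonneg_right (hBY f hf) (by linarith [hdep f])).trans ?_
      rw [Finset.sum_mul]
      refine Finset.sum_le_sum fun e _ => ?_
      by_cases hne : Y e f = 0
      · simp [hne]
      · refine mul_le_mul_of_nonneg_left ?_ (hY0 e f)
        have : (edgeDepth e : ℝ) + 1 ≤ edgeDepth f := by
          exact_mod_cast edgeDepth_lt (hYlt e f hne)
        linarith
  have h2 := Finset.sum_le_sum fun f (_ : f ∈ Finset.univ) => h1 f
  rw [Finset.sum_add_distrib, Finset.sum_comm, Finset.sum_ite_eq' Finset.univ (⊥ : T),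
    if_pos (Finset.mem_univ _)] at h2
  have h3 : ∑ e, ∑ f, Y e f * (D - edgeDepth e) ≤ ∑ e, B e * (D - edgeDepth e) :=
    Finset.sum_le_sum fun e _ => by
      rw [← Finset.sum_mul]
      exact mul_le_mul_of_nonneg_right (hYB e) (sub_nonneg.2 (hdep e))
  have h4 : ∑ f, B f * (D + 1 - edgeDepth f) = ∑ e, B e * (D - edgeDepth e) + ∑ f, B f := by
    rw [← Finset.sum_add_distrib]
    exact Finset.sum_congr rfl fun f _ => by ring
  rw [hbuy, ← hbot]
  linarith

/-! ### Charging the services to a feasible solution -/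

/-- The phase of `f` in which the `i`-th service lies: `j + 1` if `j` is the last service before the
`i`-th one in which `f` was transmitted, and `0` if there is none. -/
def phase (v : ℕ → Service T R) (f : T) : ℕ → ℕ
  | 0 => 0
  | i + 1 => if f ∈ (v i).tree then i + 1 else phase v f i

lemma phase_le (v : ℕ → Service T R) (f : T) (i : ℕ) : phase v f i ≤ i := by
  induction i with
  | zero => exact le_rfl
  | succ i ih =>
    unfold phase
    split_ifs
    · exact le_rfl
    · omega

lemma mem_tree_of_phase_eq {v : ℕ → Service T R} {f : T} {i j : ℕ} (h : phase v f i = j + 1) :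
    j < i ∧ f ∈ (v j).tree := by
  induction i with
  | zero => simp [phase] at h
  | succ i ih =>
    unfold phase at h
    split_ifs at h with hf
    · obtain rfl : i = j := by omega
      exact ⟨by omega, hf⟩
    · have := ih h
      exact ⟨by omega, this.2⟩

lemma le_phase {v : ℕ → Service T R} {f : T} {i j : ℕ} (hji : j < i) (hf : f ∈ (v j).tree) :
    j + 1 ≤ phase v f i := by
  induction i with
  | zero => omega
  | succ i ih =>
    unfold phase
    split_ifs with hfi
    · omega
    · rcases Nat.lt_succ_iff_lt_or_eq.1 hji with h | rfl
      · exact ih h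
      · exact absurd hf hfi

/-- The time `τ` lies in the phase `p` of `f`. -/
def InPhase (N : ℕ) (v : ℕ → Service T R) (f : T) (p : ℕ) (τ : ℝ) : Prop :=
  (∀ j, p = j + 1 → (v j).time < τ) ∧ ∃ i < N, phase v f i = p ∧ τ ≤ (v i).time

/-- The solution `S` buys `f` in the phase `p` of `f`. -/
def BoughtInPhase (N : ℕ) (v : ℕ → Service T R) (S : List (Transmission T)) (f : T) (p : ℕ) :
    Prop :=
  ∃ x ∈ S, f ∈ x.edges ∧ InPhase N v f p x.time

variable (I) in
/-- The solution `S` has delay at least `w(f)` on the requests of `T_f` which arrive in the phase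
`p` of `f`. -/
def DelayedInPhase (N : ℕ) (v : ℕ → Service T R) (S : List (Transmission T)) (f : T) (p : ℕ) :
    Prop :=
  I.weight f ≤ ∑ q, if f ≤ I.leaf q ∧ InPhase N v f p (I.arrival q) then
    I.delay q (I.serviceTime S q) else 0

variable (I) in
/-- In the service `v`, the budget of `e` was exhausted by investments in edges which are saturated
by the end of some period, starting at the service, in which the solution `S` does not buy `e`. -/
def PassesOn (v : Service T R) (S : List (Transmission T)) (e : T) : Prop :=
  I.weight e ≤ ∑ f, v.amount e f ∧
    ∃ u, (∀ x ∈ S, e ∈ x.edges → v.time < x.time → u < x.time) ∧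
      ∀ f, v.amount e f ≠ 0 → ∃ Q ⊆ v.pending, ∃ s, v.time ≤ s ∧ s ≤ u ∧ I.Saturates f Q s

namespace Execution

variable {N : ℕ} {s : ℕ → State T R} {v : ℕ → Service T R}

/-- Phases are half-open in time. A service of an earlier phase is no later than the service `j`
opening the later one, so `τ` would be both at most and greater than the time of `j`. -/
lemma inPhase_unique (h : I.Execution N s v) {f : T} {p p' : ℕ} {τ : ℝ}
    (hp : InPhase N v f p τ) (hp' : InPhase N v f p' τ) : p = p' := by
  wlog hlt : p < p' generalizing p p'
  · rcases Nat.lt_trichotomy p p' with h' | h' | h'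
    · exact this hp hp' h'
    · exact h'
    · exact (this hp' hp h').symm
  exfalso
  obtain ⟨i, hi, hip, hτ⟩ := hp.2
  obtain ⟨i', hi', hip', -⟩ := hp'.2
  obtain ⟨j, rfl⟩ : ∃ j, p' = j + 1 := ⟨p' - 1, by omega⟩
  obtain ⟨hj, hf⟩ := mem_tree_of_phase_eq hip'
  have hij : i ≤ j := by
    by_contra hcon
    have := le_phase (v := v) (by omega : j < i) hf
    omega
  have h1 := h.time_le hij (hj.trans hi')
  have h2 := hp'.1 j rfl
  linarith

/-- If pending requests saturate `T_f` at time `u`, before the solution `S` buys `f` again, then `S`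
buys `f` or has a large delay in the current phase of `f`, or the budget of `f` in the last service
which transmitted `f` can be charged instead. -/
lemma charge (h : I.Execution N s v) {S : List (Transmission T)} (hS : I.Feasible S) {i : ℕ}
    (hi : i < N) {f : T} {Q : Finset R} (hQ : Q ⊆ (v i).pending) {u : ℝ} (hu : (v i).time ≤ u)
    (hsat : I.Saturates f Q u)
    (hno : ∀ x ∈ S, f ∈ x.edges → (v i).time < x.time → u < x.time) :
    BoughtInPhase N v S f (phase v f i) ∨ I.DelayedInPhase N v S f (phase v f i) ∨
      ∃ j, phase v f i = j + 1 ∧ I.PassesOn (v j) S f := by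
  by_cases hb : BoughtInPhase N v S f (phase v f i)
  · exact Or.inl hb
  by_cases hd : I.DelayedInPhase N v S f (phase v f i)
  · exact Or.inr (Or.inl hd)
  refine Or.inr (Or.inr ?_)
  have harr : ∀ q ∈ Q, I.arrival q ≤ (v i).time := fun q hq => by
    have := hQ hq
    rw [(h.service i hi).pending_eq, mem_pendingAt] at this
    exact this.2
  -- the solution does not buy `f` between the start of the phase and `u`
  have hfree : ∀ x ∈ S, f ∈ x.edges → (∀ j, phase v f i = j + 1 → (v j).time < x.time) →
      u < x.time := fun x hx hfx hstart => by
    rcases le_or_gt x.time (v i).time with hle | hgt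
    · exact absurd ⟨x, hx, hfx, hstart, i, hi, rfl, hle⟩ hb
    · exact hno x hx hfx hgt
  set New : R → Prop := fun q => ∀ j, phase v f i = j + 1 → (v j).time < I.arrival q with hNew
  -- `S` serves a request of `Q` arriving in this phase only after `u`, since serving it means
  -- buying `f`; so its delay at `u` is at most what `S` pays for it.
  have hnew : I.delayOf (Q.filter New) u < I.weight f := by
    refine lt_of_le_of_lt ?_ (not_le.1 hd)
    rw [← Finset.sum_filter]
    have hsub : Q.filter New ⊆ Finset.univ.filter fun q =>
        f ≤ I.leaf q ∧ InPhase N v f (phase v f i) (I.arrival q) := fun q hq => by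
      rw [Finset.mem_filter] at hq
      simp only [Finset.mem_filter, Finset.mem_univ, true_and]
      exact ⟨hsat.1 q hq.1, hq.2, i, hi, rfl, harr q hq.1⟩
    refine le_trans (Finset.sum_le_sum fun q hq => ?_)
      (Finset.sum_le_sum_of_subset_of_nonneg hsub fun q _ _ => ?_)
    · rw [Finset.mem_filter] at hq
      obtain ⟨x, hx, h1, h2, h3⟩ := hS.exists_serviceTime q
      have hfx : f ∈ x.edges := (hS.1 x hx).2 (hsat.1 q hq.1) h3
      have := hfree x hx hfx fun j hj => (hq.2 j hj).trans_le (h1 ▸ h2)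
      exact I.delay_mono q ((harr q hq.1).trans hu) h2 (h1 ▸ this.le)
    · obtain ⟨_, _, _, h2, _⟩ := hS.exists_serviceTime q
      exact delay_nonneg_of_le h2
  have hsplit : I.delayOf (Q.filter New) u + I.delayOf (Q.filter fun q => ¬ New q) u =
      I.delayOf Q u :=
    Finset.sum_filter_add_sum_filter_not _ _ _
  -- All of `Q` has delay at least `w(T_f^Q)` and the new part less than `w(f)`, so the old part
  -- meets the hypothesis of `saturated` for service `j`.
  have hlarge : I.weightOf (I.spanned f (Q.filter fun q => ¬ New q)) <
      I.delayOf (Q.filter fun q => ¬ New q) u + I.weight f := by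
    have h1 := weightOf_mono (I := I) (spanned_mono (I := I) f (Finset.filter_subset
      (fun q => ¬ New q) Q))
    have h2 := hsat.2
    linarith
  have hne : (Q.filter fun q => ¬ New q).Nonempty := by
    by_contra hcon
    rw [Finset.not_nonempty_iff_eq_empty] at hcon
    rw [hcon] at hlarge
    have := weight_le_weightOf_spanned (I := I) f ∅
    simp only [delayOf, Finset.sum_empty] at hlarge
    linarith
  obtain ⟨q₀, hq₀⟩ := hne
  obtain ⟨j, hj⟩ : ∃ j, phase v f i = j + 1 := by
    by_contra hcon
    exact (Finset.mem_filter.1 hq₀).2 fun j hj => absurd ⟨j, hj⟩ hcon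
  obtain ⟨hji, hfj⟩ := mem_tree_of_phase_eq hj
  have hold : Q.filter (fun q => ¬ New q) ⊆ (v j).remaining := fun q hq => by
    rw [Finset.mem_filter] at hq
    refine h.mem_remaining hji hi (hQ hq.1) (not_lt.1 fun hlt => hq.2 fun j' hj' => ?_)
    obtain rfl : j' = j := by omega
    exact hlt
  have hsv := h.service j (hji.trans hi)
  have htu : (v j).time ≤ u := (h.time_le hji.le hi).trans hu
  refine ⟨j, hj, ?_, u, fun x hx hfx hlt => hfree x hx hfx fun j' hj' => ?_, fun g hg => ?_⟩
  -- An old request was left pending in `T_f`, so the loop of `f` can only have stopped by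
  -- exhausting its budget.
  · rcases hsv.exhausted f hfj with h' | h'
    · exact h'.ge
    · exact absurd (hsat.1 q₀ (Finset.mem_filter.1 hq₀).1) (h' q₀ (hold hq₀))
  · obtain rfl : j' = j := by omega
    exact hlt
  · obtain ⟨Q', hQ', s', hs', hsat', hmin⟩ := hsv.saturated f g hg
    exact ⟨Q', hQ', s', hs', hmin u htu _ hold
      (fun q hq => hsat.1 q (Finset.mem_filter.1 hq).1) hlarge, hsat'⟩

/-- The amounts invested into `f` in one phase of `f` have sum at most `w(f)`. -/
lemma sum_phase_le (h : I.Execution N s v) {f : T} (hf : f ≠ ⊥) (p : ℕ) {n : ℕ} (hn : n ≤ N) :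
    (phase v f n = p → ∑ i ∈ (Finset.range n).filter (fun i => phase v f i = p),
      ∑ e, (v i).amount e f = (s n).counter f) ∧
    ∑ i ∈ (Finset.range n).filter (fun i => phase v f i = p), ∑ e, (v i).amount e f ≤
      I.weight f := by
  -- The first conjunct strengthens the induction: within the phase in progress the sum is the
  -- current counter, which the closing service fills to exactly `w(f)`.
  induction n with
  | zero => simp [h.init, Problem.init, (I.weight_pos f).le]
  | succ n ih =>
    obtain ⟨ih₁, ih₂⟩ := ih (by omega)
    have hsv := h.service n hn
    have hle := h.counter_le hn f
    rw [Finset.range_add_one, Finset.filter_insert]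
    by_cases hp : phase v f n = p
    · rw [if_pos hp, Finset.sum_insert (by simp), ih₁ hp, add_comm (∑ e, (v n).amount e f)]
      by_cases hft : f ∈ (v n).tree
      · refine ⟨fun hp' => ?_, (hsv.counter_of_mem f hft hf).1.le⟩
        have := phase_le v f n
        rw [phase, if_pos hft] at hp'
        omega
      · rw [← hsv.counter_of_notMem f hft]
        exact ⟨fun _ => rfl, hle⟩
    · rw [if_neg hp]
      refine ⟨fun hp' => ?_, ih₂⟩
      by_cases hft : f ∈ (v n).tree
      · rw [(hsv.counter_of_mem f hft hf).2]
        refine Finset.sum_eq_zero fun i hi => ?_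
        rw [Finset.mem_filter, Finset.mem_range] at hi
        have := phase_le v f i
        rw [phase, if_pos hft] at hp'
        omega
      · rw [phase, if_neg hft] at hp'
        exact absurd hp' hp

lemma phase_bot (h : I.Execution N s v) {i : ℕ} (hi : i ≤ N) : phase v ⊥ i = i := by
  rcases i with _ | i
  · rfl
  · rw [phase, if_pos (h.service i hi).bot_mem]

end Execution

lemma sum_ite_le_of_unique (n : ℕ) {P : ℕ → Prop} (hP : ∀ i j, P i → P j → i = j) {c : ℝ}
    (hc : 0 ≤ c) : ∑ i ∈ Finset.range n, (if P i then c else 0) ≤ c := by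
  by_cases h : ∃ i, P i
  · obtain ⟨i, hi⟩ := h
    have : ∀ j, (if P j then c else 0) = if j = i then c else 0 := fun j => by
      by_cases hj : P j
      · rw [if_pos hj, if_pos (hP j i hj hi)]
      · rw [if_neg hj, if_neg fun hji => hj (by rwa [hji])]
    simp only [this, Finset.sum_ite_eq']
    split_ifs <;> simp [hc]
  · push Not at h
    simpa [h] using hc

/-! ### Summing the charges over all edges and phases -/

namespace Execution

variable {N : ℕ} {s : ℕ → State T R} {v : ℕ → Service T R}

/-- A transmission of `S` lies in at most one phase of each of its edges, so each bought edge is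
charged at most once. -/
lemma sum_bought_le (h : I.Execution N s v) (S : List (Transmission T)) :
    ∑ f, ∑ p ∈ Finset.range N, (if BoughtInPhase N v S f p then I.weight f else 0) ≤
      I.buyingCost S := by
  induction S with
  | nil => simp [BoughtInPhase, buyingCost]
  | cons a S ih =>
    have hcost : I.buyingCost (a :: S) = I.weightOf a.edges + I.buyingCost S := by
      simp [buyingCost]
    have ha : ∑ f, ∑ p ∈ Finset.range N,
        (if f ∈ a.edges ∧ InPhase N v f p a.time then I.weight f else 0) ≤
          I.weightOf a.edges := by
      have : I.weightOf a.edges = ∑ f, if f ∈ a.edges then I.weight f else 0 := by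
        simp [weightOf]
      rw [this]
      refine Finset.sum_le_sum fun f _ => ?_
      by_cases hf : f ∈ a.edges
      · simp only [hf, true_and, if_true]
        exact sum_ite_le_of_unique N (fun i j => h.inPhase_unique) (I.weight_pos f).le
      · simp [hf]
    rw [hcost]
    refine le_trans ?_ (add_le_add ha ih)
    rw [← Finset.sum_add_distrib]
    refine Finset.sum_le_sum fun f _ => ?_
    rw [← Finset.sum_add_distrib]
    refine Finset.sum_le_sum fun p _ => ?_
    have hw := (I.weight_pos f).le
    by_cases h1 : f ∈ a.edges ∧ InPhase N v f p a.time
    · rw [if_pos h1]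
      split_ifs <;> linarith
    · have : BoughtInPhase N v (a :: S) f p ↔ BoughtInPhase N v S f p := by
        simp [BoughtInPhase, h1]
      simp [this, h1]

/-- A request arrives in at most one phase of each edge on the path to its leaf edge; the number of
these edges yields the factor `D`. -/
lemma sum_delayed_le (h : I.Execution N s v) {S : List (Transmission T)} (hS : I.Feasible S) :
    ∑ f, ∑ p ∈ Finset.range N, (if I.DelayedInPhase N v S f p then I.weight f else 0) ≤
      (treeDepth T : ℝ) * I.delayCost S := by
  have h0 : ∀ q, 0 ≤ I.delay q (I.serviceTime S q) := fun q => by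
    obtain ⟨_, _, _, h2, _⟩ := hS.exists_serviceTime q
    exact delay_nonneg_of_le h2
  have h1 : ∀ f, ∑ p ∈ Finset.range N,
      (if I.DelayedInPhase N v S f p then I.weight f else 0) ≤
        ∑ q, if f ≤ I.leaf q then I.delay q (I.serviceTime S q) else 0 := fun f => by
    have : ∀ p ∈ Finset.range N, (if I.DelayedInPhase N v S f p then I.weight f else 0) ≤
        ∑ q, if f ≤ I.leaf q ∧ InPhase N v f p (I.arrival q) then
          I.delay q (I.serviceTime S q) else 0 := fun p _ => by
      split_ifs with hd
      · exact hd
      · exact Finset.sum_nonneg fun q _ => by split_ifs; exacts [h0 q, le_rfl]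
    refine (Finset.sum_le_sum this).trans ?_
    rw [Finset.sum_comm]
    refine Finset.sum_le_sum fun q _ => ?_
    by_cases hf : f ≤ I.leaf q
    · simp only [hf, true_and, if_true]
      exact sum_ite_le_of_unique N (fun i j => h.inPhase_unique) (h0 q)
    · simp [hf]
  refine (Finset.sum_le_sum fun f _ => h1 f).trans ?_
  rw [Finset.sum_comm, delayCost, Finset.mul_sum]
  refine Finset.sum_le_sum fun q _ => ?_
  rw [← Finset.sum_filter, Finset.sum_const, nsmul_eq_mul]
  refine mul_le_mul_of_nonneg_right ?_ (h0 q)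
  exact_mod_cast edgeDepth_le (I.leaf q)

/-- The total weight of the root edges bought by the algorithm, compared with a feasible
solution. -/
lemma root_cost_le (h : I.Execution N s v) {S : List (Transmission T)} (hS : I.Feasible S) :
    N * I.weight ⊥ ≤ I.buyingCost S + (treeDepth T : ℝ) * I.delayCost S := by
  -- A flow of charges: `G` is absorbed by costs of `S`, `F` is passed on (indexed by phase), `M`
  -- totals what is passed on (indexed by service), and `Z` is what arrives at `f` from edges
  -- passing on.
  set G : T → ℕ → ℝ := fun f p => (if BoughtInPhase N v S f p then I.weight f else 0) +
    if I.DelayedInPhase N v S f p then I.weight f else 0 with hG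
  set F : T → ℕ → ℝ := fun f p =>
    if ∃ j, p = j + 1 ∧ I.PassesOn (v j) S f then I.weight f else 0 with hF
  set M : T → ℝ := fun f =>
    ∑ i ∈ Finset.range N, if I.PassesOn (v i) S f then I.weight f else 0 with hM
  set Z : T → ℕ → ℝ := fun f i => ∑ e, if I.PassesOn (v i) S e then (v i).amount e f else 0 with hZ
  have hG0 : ∀ f p, 0 ≤ G f p := fun f p => by
    have := (I.weight_pos f).le
    simp only [hG]
    split_ifs <;> linarith
  have hF0 : ∀ f p, 0 ≤ F f p := fun f p => by
    have := (I.weight_pos f).le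
    simp only [hF]
    split_ifs <;> linarith
  have hGF : ∀ f p, BoughtInPhase N v S f p ∨ I.DelayedInPhase N v S f p ∨
      (∃ j, p = j + 1 ∧ I.PassesOn (v j) S f) → I.weight f ≤ G f p + F f p := fun f p hc => by
    have hw := (I.weight_pos f).le
    simp only [hG, hF]
    rcases hc with hc | hc | hc
    all_goals
      rw [if_pos hc]
      split_ifs <;> linarith
  -- Phase `j + 1` corresponds to service `j`, hence the index shift; phase `0` passes nothing on.
  have hFM : ∀ f, ∑ p ∈ Finset.range N, F f p ≤ M f := fun f => by
    refine (Finset.sum_le_sum_of_subset_of_nonneg (Finset.range_mono (Nat.le_succ N))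
      fun p _ _ => hF0 f p).trans ?_
    rw [Finset.sum_range_succ']
    simp [hF, hM]
  -- Flow balance at `f`. Each service injects `w(⊥)` at the root edge, where it forms a phase of
  -- its own; elsewhere a phase which receives anything receives at most `w(f)` and, by `charge`,
  -- absorbs it or passes it on.
  have hmain : ∀ f, ∑ i ∈ Finset.range N, Z f i + (if f = ⊥ then N * I.weight ⊥ else 0) ≤
      ∑ p ∈ Finset.range N, G f p + M f := by
    intro f
    refine le_trans ?_ (add_le_add_right (hFM f) _)
    rw [← Finset.sum_add_distrib]
    by_cases hf : f = ⊥
    · subst hf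
      have hZ0 : ∑ i ∈ Finset.range N, Z ⊥ i = 0 := Finset.sum_eq_zero fun i hi =>
        Finset.sum_eq_zero fun e _ => by
          split_ifs
          · by_contra hne
            exact not_lt_bot ((h.service i (Finset.mem_range.1 hi)).support e ⊥ hne).1
          · rfl
      have hconst : (N : ℝ) * I.weight ⊥ = ∑ i ∈ Finset.range N, I.weight ⊥ := by simp
      rw [hZ0, zero_add, if_pos rfl, hconst]
      refine Finset.sum_le_sum fun i hi => hGF ⊥ i ?_
      rw [Finset.mem_range] at hi
      obtain ⟨Q, hQ, hsat⟩ := (h.service i hi).isLeast.1.2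
      rw [← (h.service i hi).pending_eq] at hQ
      have := h.charge hS hi hQ le_rfl hsat fun x _ _ hx => hx
      rwa [h.phase_bot hi.le] at this
    · rw [if_neg hf, add_zero, ← Finset.sum_fiberwise_of_maps_to (g := phase v f)
        (t := Finset.range N) (fun i hi => Finset.mem_range.2
          ((phase_le v f i).trans_lt (Finset.mem_range.1 hi)))]
      refine Finset.sum_le_sum fun p _ => ?_
      by_cases hc : BoughtInPhase N v S f p ∨ I.DelayedInPhase N v S f p ∨
          ∃ j, p = j + 1 ∧ I.PassesOn (v j) S f
      · refine le_trans (Finset.sum_le_sum fun i hi => Finset.sum_le_sum fun e _ => ?_)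
          ((h.sum_phase_le hf p le_rfl).2.trans (hGF f p hc))
        have := (h.service i (Finset.mem_range.1 (Finset.mem_filter.1 hi).1)).nonneg e f
        split_ifs
        exacts [le_rfl, this]
      · refine le_trans (le_of_eq (Finset.sum_eq_zero fun i hi => Finset.sum_eq_zero fun e _ => ?_))
          (add_nonneg (hG0 f p) (hF0 f p))
        rw [Finset.mem_filter, Finset.mem_range] at hi
        obtain ⟨hi, rfl⟩ := hi
        split_ifs with hpass
        · by_contra hne
          obtain ⟨-, u, hu, hsat⟩ := hpass
          obtain ⟨Q, hQ, s', h1, h2, h3⟩ := hsat f hne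
          -- Subtrees are closed towards the root, so `S` cannot buy `f` without its ancestor `e`,
          -- which it does not buy until after `u`.
          refine hc (h.charge hS hi hQ h1 h3 fun x hx hfx hlt => h2.trans_lt (hu x hx ?_ hlt))
          exact (hS.1 x hx).2 ((h.service i hi).support e f hne).1.le hfx
        · rfl
  -- An edge passing on has invested its full weight, so no charge is lost; `Z` then cancels from
  -- the summed balances.
  have hMZ : ∑ f, M f ≤ ∑ f, ∑ i ∈ Finset.range N, Z f i := by
    rw [Finset.sum_comm (f := Z), Finset.sum_comm]
    refine Finset.sum_le_sum fun i _ => ?_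
    rw [Finset.sum_comm]
    refine Finset.sum_le_sum fun e _ => ?_
    split_ifs with hp
    · exact hp.1
    · simp
  have hsum := Finset.sum_le_sum fun f (_ : f ∈ Finset.univ) => hmain f
  rw [Finset.sum_add_distrib, Finset.sum_add_distrib, Finset.sum_ite_eq' Finset.univ (⊥ : T),
    if_pos (Finset.mem_univ _)] at hsum
  have hGsum : ∑ f, ∑ p ∈ Finset.range N, G f p ≤
      I.buyingCost S + (treeDepth T : ℝ) * I.delayCost S := by
    simp only [hG, Finset.sum_add_distrib]
    exact add_le_add (h.sum_bought_le S) (h.sum_delayed_le hS)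
  linarith

end Execution

/-- The cost is at most twice the buying cost plus the delay of `S`. The first two bounds give
coefficients `2 * D` and `2 * D ^ 2`, and the remaining delay term raises the constant to at most
`3`. -/
lemma Reachable.cost_le {s : State T R} (hr : I.Reachable s) (hf : I.Final s)
    {S : List (Transmission T)} (hS : I.Feasible S) :
    I.cost s.log ≤ 3 * (treeDepth T : ℝ) * I.buyingCost S +
      3 * (treeDepth T : ℝ) ^ 2 * I.delayCost S := by
  obtain ⟨N, s', v, hex, rfl⟩ := hr.exists_execution
  have h1 := hr.sound.delayCost_le hf hS
  have h2 := hex.buyingCost_le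
  have h3 := hex.root_cost_le hS
  have hD : (1 : ℝ) ≤ treeDepth T := by exact_mod_cast one_le_treeDepth (T := T)
  have hB0 : 0 ≤ I.buyingCost S := List.sum_nonneg fun y hy => by
    obtain ⟨x, _, rfl⟩ := List.mem_map.1 hy
    exact weightOf_nonneg _
  have hD0 : 0 ≤ I.delayCost S := Finset.sum_nonneg fun q _ => by
    obtain ⟨_, _, _, h2, _⟩ := hS.exists_serviceTime q
    exact delay_nonneg_of_le h2
  have h4 := h2.trans (mul_le_mul_of_nonneg_left h3 (by linarith))
  have h5 : 0 ≤ (treeDepth T : ℝ) * I.buyingCost S := mul_nonneg (by linarith) hB0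
  have h6 : I.delayCost S ≤ (treeDepth T : ℝ) ^ 2 * I.delayCost S :=
    le_mul_of_one_le_left hD0 (one_le_pow₀ hD)
  unfold cost
  linarith

end Problem

end Multilevel

end

theorem mainTheorem5 :
    ∃ C : ℝ, 0 < C ∧
      ∀ (T : RootedTree) [Fintype T] (R : Type*) [Fintype R] (I : Multilevel.Problem T R),
        I.IsHST 2 →
        -- the algorithm makes finitely many services, and is never stuck before a final state
        (¬ ∃ s : ℕ → Multilevel.State T R, s 0 = I.init ∧ ∀ n, I.Step (s n) (s (n + 1))) ∧
        (∀ s, I.Reachable s → ∃ s', Relation.ReflTransGen I.Step s s' ∧ I.Final s') ∧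
        -- every complete execution is a feasible solution satisfying the bound
        ∀ s, I.Reachable s → I.Final s →
          I.Feasible s.log ∧
          ∀ S : List (Multilevel.Transmission T), I.Feasible S →
            I.cost s.log ≤
              C * (Multilevel.treeDepth T : ℝ) * I.buyingCost S +
              C * (Multilevel.treeDepth T : ℝ) ^ 2 * I.delayCost S := by
  refine ⟨3, by norm_num, fun T _ R _ I hI => ⟨?_, fun s hs => ?_, fun s hs hf => ?_⟩⟩
  · exact Multilevel.Problem.not_exists_infinite_execution hI
  · exact (Multilevel.Problem.Reachable.sound hs).exists_final hI _ le_rfl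
  · exact ⟨(Multilevel.Problem.Reachable.sound hs).feasible hf,
      fun S hS => Multilevel.Problem.Reachable.cost_le hs hf hS⟩
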